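/- **Definitions.** Let $d\ge 1$. A lattice in $\mathbb R^d$ is a full-rank discrete subgroup. For $m\ge 1$, a *periodic form* $X=(Q,t)\in\mathcal S^{d,m}_{>0}$ consists of a real symmetric positive definite $d\times d$ matrix $Q$ and vectors $t_1,\dots,t_{m-1}\in\mathbb R^d$; put $t_m=0$ and $Q[x]=x^{\mathsf T}Qx$. Its generalized arithmetical minimum and its density are $$\lambda(X)=\min\{Q[t_i-t_j-v] : 1\le i,j\le m,\ v\in\mathbb Z^d,\ v\ne 0 \text{ if } i=j\},$$ $$\delta(X)=\left(\frac{\lambda(X)}{(\det Q)^{1/d}}\right)^{d/2}\frac{m\,\mathrm{vol}(B^d)}{2^d},$$ where $B^d$ is the Euclidean unit ball. The form $X$ *represents* a set $\Lambda\subset\mathbb R^d$ if $t_1,\dots,t_m$ are pairwise incongruent modulo $\mathbb Z^d$ and, for some $A\in \mathrm{GL}_d(\mathbb R)$ with $A^{\mathsf T}A=Q$, the set $\Lambda$ is isometric (by an isometry of $\mathbb R^d$) to $A\bigl(\bigcup_{i=1}^m(t_i+\mathbb Z^d)\bigr)$. * $X$ is *$m$-extreme* if $\delta$ restricted to $\mathcal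 S^{d,m}_{>0}$ has a local maximum at $X$. It is *isolated $m$-extreme* if $X$ has a neighbourhood $U$ in $\mathcal S^{d,m}_{>0}$ such that $\delta(Y)<\delta(X)$ for all $Y\in U\setminus\{X\}$ with $\lambda(Y)=\lambda(X)$. * A lattice is *extreme* if it is represented by a $1$-extreme form, i.e. $\delta$ has a local maximum on the cone of positive definite symmetric matrices at a Gram matrix of the lattice. * A set is *strict periodic extreme* if, for every $m\ge1$, every periodic form in $\mathcal S^{d,m}_{>0}$ representing it is isolated $m$-extreme. * A set $\Lambda$ is *floating* if it can be written as a union $\bigcup_{i=1}^m(t_i+L)$ of $m$ pairwise distinct translates of a lattice $L$ for which there are a nonempty strict subset $I\subsetneq\{1,\dots,m\}$ and continuous paths $\gamma_i:[0,1]\to\mathbb R^d$ with $\gamma_i(0)=t_i$, where $\gamma_i$ is non-constant for $i\in I$ and constant for $i\notin I$, such that for every $s\in[0,1]$ the translates $\gamma_i(s)+L$ are pairwise distinct and the minimum distance between distinct points of $\bigcup_i(\gamma_i(s)+L)$ is at least that of $\Lambda$. Otherwise $\Lambda$ is *non-floating*. **Theorem.** A lattice in $\mathbb R^d$ is strict periodic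 extreme if and only if it is extreme and non-floating. -/

import Mathlib

open Filter Topology MeasureTheory
open scoped Matrix

noncomputable section

namespace StrictPeriodic

/-- The ambient space `S^{d,m}` for `m = k + 1`: a `d × d` matrix `Q` together with the `m - 1 = k`
free translation vectors `t_1, …, t_{m-1}`; the last one, `t_m`, is normalized to be `0`.
Symmetry of `Q` is part of membership in `periodicForms`. -/
abbrev FormSpace (d k : ℕ) : Type :=
  Matrix (Fin d) (Fin d) ℝ × (Fin k → Fin d → ℝ)

/-- The periodic forms `S^{d,m}_{>0}`, `m = k + 1`: the matrix is symmetric positive definite. -/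
def periodicForms (d k : ℕ) : Set (FormSpace d k) :=
  {X | X.1.PosDef}

/-- All `m = k + 1` translation vectors `t_1, …, t_{m-1}, t_m = 0` of a periodic form. -/
def translation {d k : ℕ} (X : FormSpace d k) : Fin (k + 1) → Fin d → ℝ :=
  Fin.snoc (α := fun _ => Fin d → ℝ) X.2 0

/-- The value `Q[x] = xᵗ Q x`. -/
def quadValue {d : ℕ} (Q : Matrix (Fin d) (Fin d) ℝ) (x : Fin d → ℝ) : ℝ :=
  x ⬝ᵥ (Q *ᵥ x)

/-- An integer vector, viewed as a real vector. -/
def intVec {d : ℕ} (v : Fin d → ℤ) : Fin d → ℝ :=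
  fun a => (v a : ℝ)

/-- The generalized arithmetical minimum `λ(X)`: the minimum of `Q[t_i - t_j - v]` over all
`i, j` and all integer vectors `v`, with `v ≠ 0` if `i = j`. -/
def arithMin {d k : ℕ} (X : FormSpace d k) : ℝ :=
  sInf {r | ∃ (i j : Fin (k + 1)) (v : Fin d → ℤ), (i = j → v ≠ 0) ∧
    r = quadValue X.1 (translation X i - translation X j - intVec v)}

/-- The sphere packing density
`δ(X) = (λ(X) / (det Q)^{1/d})^{d/2} · m · vol(B^d) / 2^d`, with `m = k + 1`. -/
def density {d k : ℕ} (X : FormSpace d k) : ℝ :=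
  (arithMin X / X.1.det ^ (1 / (d : ℝ))) ^ ((d : ℝ) / 2) * ((k : ℝ) + 1) *
    (volume (Metric.ball (0 : EuclideanSpace ℝ (Fin d)) 1)).toReal / 2 ^ d

/-- `X` is `m`-extreme (`m = k + 1`): a periodic form at which `δ` has a local maximum within the
space of periodic forms. -/
def IsMExtreme {d k : ℕ} (X : FormSpace d k) : Prop :=
  X ∈ periodicForms d k ∧ IsLocalMaxOn density (periodicForms d k) X

/-- `X` is isolated `m`-extreme (`m = k + 1`): every sufficiently small nonzero change of the
periodic form `X` that preserves `λ` strictly lowers `δ`. -/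
def IsIsolatedMExtreme {d k : ℕ} (X : FormSpace d k) : Prop :=
  X ∈ periodicForms d k ∧
    ∀ᶠ Y in 𝓝[periodicForms d k] X, Y ≠ X → arithMin Y = arithMin X → density Y < density X

/-- The standard periodic set `Λ_t = ⋃ i, (t_i + ℤ^d)` of a periodic form. -/
def standardSet {d k : ℕ} (X : FormSpace d k) : Set (Fin d → ℝ) :=
  {y | ∃ (i : Fin (k + 1)) (v : Fin d → ℤ), y = translation X i + intVec v}

/-- The periodic form `X = (Q, t)` represents the point set `Λ` as a union of `m = k + 1` distinct
translates: `Q = Aᵗ A` with `A ∈ GL_d(ℝ)`, the `t_i` are pairwise incongruent modulo `ℤ^d`, and `Λ`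
is `A Λ_t` up to isometry.  (Orthogonal maps are absorbed by `A`, so that only a translation by
some `b` remains.) -/
def Represents {d k : ℕ} (X : FormSpace d k) (Λ : Set (EuclideanSpace ℝ (Fin d))) : Prop :=
  (∀ i j : Fin (k + 1), i ≠ j → ∀ v : Fin d → ℤ, translation X i - translation X j ≠ intVec v) ∧
  ∃ (A : Matrix (Fin d) (Fin d) ℝ) (b : Fin d → ℝ), IsUnit A.det ∧ X.1 = Aᵀ * A ∧
    Λ = (fun y : Fin d → ℝ => WithLp.toLp 2 (b + A *ᵥ y)) '' standardSet X

/-- A point set is strict periodic extreme: every representation of it by a periodic form, for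
every `m = k + 1`, is isolated `m`-extreme. -/
def IsStrictPeriodicExtreme {d : ℕ} (Λ : Set (EuclideanSpace ℝ (Fin d))) : Prop :=
  ∀ (k : ℕ) (X : FormSpace d k), Represents X Λ → IsIsolatedMExtreme X

/-- A lattice is extreme (locally optimal among lattices): it is represented by a `1`-extreme
form, that is, `δ` has a local maximum at one of its Gram matrices. -/
def IsExtreme {d : ℕ} (Λ : Set (EuclideanSpace ℝ (Fin d))) : Prop :=
  ∃ X : FormSpace d 0, Represents X Λ ∧ IsMExtreme X

/-- The union `⋃ i, (t_i + L)` of translates of `L`. -/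
def unionTranslates {d m : ℕ} (L : Submodule ℤ (EuclideanSpace ℝ (Fin d)))
    (t : Fin m → EuclideanSpace ℝ (Fin d)) : Set (EuclideanSpace ℝ (Fin d)) :=
  {x | ∃ i : Fin m, ∃ v ∈ L, x = t i + v}

/-- The translates `t_i + L` are pairwise distinct. -/
def DistinctTranslates {d m : ℕ} (L : Submodule ℤ (EuclideanSpace ℝ (Fin d)))
    (t : Fin m → EuclideanSpace ℝ (Fin d)) : Prop :=
  ∀ i j : Fin m, i ≠ j → t i - t j ∉ L

/-- A point set `Λ` is floating: it is a union of `m` distinct translates of a lattice `L`, and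
there is a continuous motion `γ` of the translates (over the time interval `[0, 1]`, starting at
the given position) such that the moving translates are exactly those with index in a nonempty
strict subset `I` of the `m` indices, and at every time the translates remain distinct and the
minimum distance of the moved set is at least that of `Λ`.  (`Set.infsep` is the infimum of the
distances between distinct points.) -/
def IsFloating {d : ℕ} (Λ : Set (EuclideanSpace ℝ (Fin d))) : Prop :=
  ∃ (L : Submodule ℤ (EuclideanSpace ℝ (Fin d))) (_ : DiscreteTopology L) (_ : IsZLattice ℝ L)
    (m : ℕ) (t : Fin m → EuclideanSpace ℝ (Fin d)),
    DistinctTranslates L t ∧ Λ = unionTranslates L t ∧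
    ∃ (I : Set (Fin m)) (γ : ℝ → Fin m → EuclideanSpace ℝ (Fin d)),
      I.Nonempty ∧ I ≠ Set.univ ∧
      ContinuousOn γ (Set.Icc 0 1) ∧ γ 0 = t ∧
      (∀ i ∈ I, ∃ s ∈ Set.Icc (0 : ℝ) 1, γ s i ≠ t i) ∧
      (∀ i ∉ I, ∀ s ∈ Set.Icc (0 : ℝ) 1, γ s i = t i) ∧
      ∀ s ∈ Set.Icc (0 : ℝ) 1,
        DistinctTranslates L (γ s) ∧ Λ.infsep ≤ (unionTranslates L (γ s)).infsep

end StrictPeriodic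

end

/-! Let `X = (Q, t)` represent a lattice. A minimal vector `w` of the lattice maps the lattice to
itself by translation, so it permutes the `m` translates by some `σ`, and every translate `i`
touches `σ i` along `w`. Perturb `Q` by `H` and `t` by `n`, and let `D i` be the relative motion of
translates `i` and `σ i`. The squared length of this contact changes by `H[w] + 2 wᵀQ(D i)` plus `2
wᵀH(D i)` and the nonnegative term `(Q + H)[D i]`. Since `σ` is a permutation, the terms linear in
`D` cancel when summed over `i` (`sum_contactMap`), which decouples the two kinds of motion.

Extreme and non-floating implies strict periodic extreme. Suppose the perturbation keeps `λ` and
does not lower the density. Averaging over `i` gives `H[w] ≥ -O(‖n‖²)` for all minimal `w`, while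
the determinant has not grown. Extremality excludes a nonzero `H` with `H[w] ≥ 0` for all `w` and
`tr (Q⁻¹H) ≤ 0`; the compactness form of this (`VoronoiRigid.exists_pos`) yields `‖H‖ = O(‖n‖²)`. If
`n ≠ 0`, then some contact shrinks to first order in `n`. Otherwise all first-order changes are
nonnegative with sum zero, hence zero, and moving along `n` at constant speed only lengthens
contacts, so the lattice floats (`isFloating_of_contactMap_eq_zero`). For small `n` the first-order
loss beats the quadratic terms, so `n = 0` and then `H = 0` (`isIsolatedMExtreme_of_rigid`).

Conversely, the case `m = 1` gives extremality after rescaling to a fixed `λ`. A floating motion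
keeps the determinant and does not decrease `λ`, hence never lowers the density; isolation then
forces it to stay at its starting point, by connectedness of `[0, 1]`. -/

noncomputable section

namespace StrictPeriodic

-- Entrywise sup norm; only orders of magnitude matter, so any norm would serve.
attribute [local instance] Matrix.normedAddCommGroup Matrix.normedSpace

/-! ### Determinant inequality and a compactness principle for linear functionals. -/

section Auxiliary

open scoped MatrixOrder in
theorem _root_.Matrix.PosDef.exists_transpose_mul_self {d : ℕ} {P : Matrix (Fin d) (Fin d) ℝ}
    (hP : P.PosDef) : ∃ B : Matrix (Fin d) (Fin d) ℝ, IsUnit B.det ∧ P = Bᵀ * B := by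
  obtain ⟨B, hB⟩ := CStarAlgebra.nonneg_iff_eq_star_mul_self.mp hP.posSemidef.nonneg
  rw [Matrix.star_eq_conjTranspose, Matrix.conjTranspose_eq_transpose_of_trivial] at hB
  refine ⟨B, ?_, hB⟩
  have := hP.det_pos
  rw [hB, Matrix.det_mul, Matrix.det_transpose] at this
  exact isUnit_iff_ne_zero.mpr fun h => by simp [h] at this

theorem posDef_transpose_mul_mul {d : ℕ} {P B : Matrix (Fin d) (Fin d) ℝ}
    (hP : P.PosDef) (hB : IsUnit B.det) : (Bᵀ * P * B).PosDef := by
  have := hP.conjTranspose_mul_mul_same (B := B)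
    (Matrix.mulVec_injective_of_isUnit ((Matrix.isUnit_iff_isUnit_det B).mpr hB))
  rwa [Matrix.conjTranspose_eq_transpose_of_trivial] at this

theorem posDef_transpose_mul_self {d : ℕ} {B : Matrix (Fin d) (Fin d) ℝ}
    (hB : IsUnit B.det) : (Bᵀ * B).PosDef := by
  simpa using posDef_transpose_mul_mul Matrix.PosDef.one hB

/-- Strict arithmetic-geometric mean inequality for the eigenvalues of `N`. -/
theorem det_lt_exp_trace {d : ℕ} {N : Matrix (Fin d) (Fin d) ℝ} (hN : N.PosDef) (h1 : N ≠ 1) :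
    N.det < Real.exp (N.trace - d) := by
  have hH := hN.isHermitian
  have hdet : N.det = ∏ i, hH.eigenvalues i := by simpa using hH.det_eq_prod_eigenvalues
  have htr : N.trace = ∑ i, hH.eigenvalues i := by simpa using hH.trace_eq_sum_eigenvalues
  have hsum : N.trace - d = ∑ i, (hH.eigenvalues i - 1) := by
    rw [Finset.sum_sub_distrib, ← htr]; simp
  rw [hsum, Real.exp_sum, hdet]
  have hne : ∃ i, hH.eigenvalues i ≠ 1 := by
    by_contra! hall
    apply h1
    rw [hH.spectral_theorem]
    have : (RCLike.ofReal ∘ hH.eigenvalues : Fin d → ℝ) = fun _ => 1 := by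
      ext i; simp [hall i]
    rw [this, Matrix.diagonal_one, map_one]
  obtain ⟨i, hi⟩ := hne
  refine Finset.prod_lt_prod (fun j _ => hN.eigenvalues_pos j) (fun j _ => ?_)
    ⟨i, Finset.mem_univ _, ?_⟩
  · have := Real.add_one_le_exp (hH.eigenvalues j - 1)
    linarith
  · have := Real.add_one_lt_exp (sub_ne_zero.mpr hi)
    linarith

/-- Strict concavity of `log det`, with its gradient `P⁻¹` at `P`. A congruence moves `P` to the
identity, where it is the eigenvalue inequality `x ≤ exp (x - 1)`. -/
theorem det_lt_det_mul_exp {d : ℕ} {P R : Matrix (Fin d) (Fin d) ℝ} (hP : P.PosDef)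
    (hR : R.PosDef) (hne : R ≠ P) : R.det < P.det * Real.exp ((P⁻¹ * (R - P)).trace) := by
  obtain ⟨B, hB, rfl⟩ := hP.exists_transpose_mul_self
  have hB' : IsUnit (B⁻¹).det := Matrix.isUnit_nonsing_inv_det B hB
  have hBt : IsUnit (Bᵀ).det := by rwa [Matrix.det_transpose]
  set N := (B⁻¹)ᵀ * R * B⁻¹ with hN
  have hRN : R = Bᵀ * N * B := by
    rw [hN, Matrix.transpose_nonsing_inv]
    simp only [Matrix.mul_assoc, Matrix.nonsing_inv_mul B hB, Matrix.mul_one]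
    rw [← Matrix.mul_assoc, Matrix.mul_nonsing_inv _ hBt, Matrix.one_mul]
  have hN1 : N ≠ 1 := fun h => hne (by rw [hRN, h, Matrix.mul_one])
  have hlt := det_lt_exp_trace (posDef_transpose_mul_mul hR hB') hN1
  have htr : ((Bᵀ * B)⁻¹ * (R - Bᵀ * B)).trace = N.trace - d := by
    rw [Matrix.mul_sub, Matrix.trace_sub, Matrix.nonsing_inv_mul _ hP.det_pos.ne'.isUnit,
      Matrix.trace_one, Fintype.card_fin, Matrix.mul_inv_rev, hN, Matrix.transpose_nonsing_inv,
      Matrix.mul_assoc, Matrix.trace_mul_comm]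
  rw [htr]
  have hdet : R.det = (Bᵀ * B).det * N.det := by
    conv_lhs => rw [hRN]
    simp only [Matrix.det_mul]; ring
  rw [hdet]
  exact mul_lt_mul_of_pos_left hlt hP.det_pos

/-- If finitely many linear functionals are simultaneously nonnegative only at the origin of a
closed cone, then on that cone one of them is always uniformly negative. -/
theorem exists_le_neg_mul_norm {V ι : Type*} [NormedAddCommGroup V] [NormedSpace ℝ V]
    [FiniteDimensional ℝ V] [Finite ι] (f : ι → V →ₗ[ℝ] ℝ) {S : Set V} (hS : IsClosed S)
    (hcone : ∀ c : ℝ, ∀ x ∈ S, c • x ∈ S) (h : ∀ x ∈ S, (∀ i, 0 ≤ f i x) → x = 0) :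
    ∃ c > 0, ∀ x ∈ S, x ≠ 0 → ∃ i, f i x ≤ -(c * ‖x‖) := by
  have := Fintype.ofFinite ι
  have : ProperSpace V := FiniteDimensional.proper_real V
  have hf : ∀ i, Continuous (f i) := fun i => (f i).continuous_of_finiteDimensional
  -- The sum of the negative parts is continuous and positive on the compact unit sphere of `S`,
  -- hence bounded below there by some `a > 0`.
  obtain ⟨a, ha, hmin⟩ := ((isCompact_sphere (0 : V) 1).inter_right hS).exists_forall_le'
    (f := fun x => ∑ i, max 0 (-(f i x)))
    (by fun_prop) (a := 0) (by
      rintro x ⟨hx, hxS⟩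
      by_contra! hle
      have hnn : ∀ i ∈ Finset.univ, 0 ≤ max 0 (-(f i x)) := fun i _ => le_max_left _ _
      have h0 := (Finset.sum_eq_zero_iff_of_nonneg hnn).mp
        (le_antisymm hle (Finset.sum_nonneg hnn))
      have : x = 0 := h x hxS fun i => by
        have := h0 i (Finset.mem_univ i)
        have h2 := le_max_right 0 (-(f i x))
        linarith
      simp [this] at hx)
  -- Pigeonhole: some summand exceeds this share of `a`. The `+ 1` covers an empty index type.
  refine ⟨a / (Fintype.card ι + 1), by positivity, fun x hxS hx => ?_⟩
  have hxn : 0 < ‖x‖ := norm_pos_iff.mpr hx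
  have hy := hmin (‖x‖⁻¹ • x) ⟨by simp [norm_smul, hxn.ne'], hcone _ _ hxS⟩
  by_contra! hall
  have hlt : ∀ i, max 0 (-(f i (‖x‖⁻¹ • x))) ≤ a / (Fintype.card ι + 1) := fun i => by
    refine max_le (by positivity) ?_
    have := hall i
    rw [map_smul, smul_eq_mul, ← div_eq_inv_mul, ← neg_div, div_le_iff₀ hxn]
    linarith
  have hsum := Finset.sum_le_sum fun i (_ : i ∈ Finset.univ) => hlt i
  rw [Finset.sum_const, Finset.card_univ, nsmul_eq_mul] at hsum
  have : (Fintype.card ι : ℝ) * (a / (Fintype.card ι + 1)) < a := by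
    rw [mul_div_assoc', div_lt_iff₀ (by positivity)]
    nlinarith
  linarith

end Auxiliary

/-! ### Quadratic forms: algebra, norm bounds, coercivity. -/

section QuadraticForms

variable {d : ℕ}

theorem quadValue_add_left (Q H : Matrix (Fin d) (Fin d) ℝ) (x : Fin d → ℝ) :
    quadValue (Q + H) x = quadValue Q x + quadValue H x := by
  simp [quadValue, Matrix.add_mulVec, dotProduct_add]

theorem quadValue_smul_left (c : ℝ) (Q : Matrix (Fin d) (Fin d) ℝ) (x : Fin d → ℝ) :
    quadValue (c • Q) x = c * quadValue Q x := by
  simp [quadValue, Matrix.smul_mulVec, dotProduct_smul]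

theorem quadValue_smul_right (c : ℝ) (Q : Matrix (Fin d) (Fin d) ℝ) (x : Fin d → ℝ) :
    quadValue Q (c • x) = c ^ 2 * quadValue Q x := by
  simp [quadValue, Matrix.mulVec_smul, dotProduct_smul]; ring

theorem quadValue_add_right {Q : Matrix (Fin d) (Fin d) ℝ} (hQ : Qᵀ = Q) (x y : Fin d → ℝ) :
    quadValue Q (x + y) = quadValue Q x + 2 * (x ⬝ᵥ Q *ᵥ y) + quadValue Q y := by
  have : y ⬝ᵥ Q *ᵥ x = x ⬝ᵥ Q *ᵥ y := by
    rw [Matrix.dotProduct_mulVec, ← Matrix.mulVec_transpose, hQ, dotProduct_comm]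
  simp only [quadValue, Matrix.mulVec_add, dotProduct_add, add_dotProduct, this]
  ring

theorem quadValue_transpose_mul_mul (B Q : Matrix (Fin d) (Fin d) ℝ) (x : Fin d → ℝ) :
    quadValue (Bᵀ * Q * B) x = quadValue Q (B *ᵥ x) := by
  simp only [quadValue, ← Matrix.mulVec_mulVec]
  rw [Matrix.dotProduct_mulVec, Matrix.vecMul_transpose]

theorem quadValue_transpose_mul_self (B : Matrix (Fin d) (Fin d) ℝ) (x : Fin d → ℝ) :
    quadValue (Bᵀ * B) x = ‖WithLp.toLp 2 (B *ᵥ x)‖ ^ 2 := by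
  rw [EuclideanSpace.real_norm_sq_eq, quadValue, ← Matrix.mulVec_mulVec,
    Matrix.dotProduct_mulVec, Matrix.vecMul_transpose]
  simp [dotProduct, sq]

theorem quadValue_pos {Q : Matrix (Fin d) (Fin d) ℝ} (hQ : Q.PosDef) {x : Fin d → ℝ}
    (hx : x ≠ 0) : 0 < quadValue Q x := by
  simpa [quadValue] using hQ.dotProduct_mulVec_pos hx

theorem quadValue_nonneg {Q : Matrix (Fin d) (Fin d) ℝ} (hQ : Q.PosDef) (x : Fin d → ℝ) :
    0 ≤ quadValue Q x := by
  simpa [quadValue] using hQ.posSemidef.dotProduct_mulVec_nonneg x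

theorem abs_dotProduct_mulVec_le (H : Matrix (Fin d) (Fin d) ℝ) (x y : Fin d → ℝ) :
    |x ⬝ᵥ H *ᵥ y| ≤ d ^ 2 * ‖H‖ * ‖x‖ * ‖y‖ := by
  have h1 : ∀ i, |x i * (H *ᵥ y) i| ≤ d * ‖H‖ * ‖x‖ * ‖y‖ := fun i => by
    have h2 : |(H *ᵥ y) i| ≤ d * (‖H‖ * ‖y‖) := by
      refine (Finset.abs_sum_le_sum_abs (fun j => H i j * y j) Finset.univ).trans ?_
      refine (Finset.sum_le_card_nsmul _ _ (‖H‖ * ‖y‖) fun j _ => ?_).trans (by simp)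
      rw [abs_mul]
      exact mul_le_mul (Matrix.norm_entry_le_entrywise_sup_norm H) (norm_le_pi_norm y j)
        (abs_nonneg _) (norm_nonneg _)
    rw [abs_mul]
    calc |x i| * |(H *ᵥ y) i| ≤ ‖x‖ * (d * (‖H‖ * ‖y‖)) :=
          mul_le_mul (norm_le_pi_norm x i) h2 (abs_nonneg _) (norm_nonneg _)
      _ = _ := by ring
  refine (Finset.abs_sum_le_sum_abs (fun i => x i * (H *ᵥ y) i) Finset.univ).trans ?_
  refine (Finset.sum_le_card_nsmul _ _ (d * ‖H‖ * ‖x‖ * ‖y‖) fun i _ => h1 i).trans (le_of_eq ?_)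
  simp; ring

theorem abs_quadValue_le (H : Matrix (Fin d) (Fin d) ℝ) (x : Fin d → ℝ) :
    |quadValue H x| ≤ d ^ 2 * ‖H‖ * ‖x‖ ^ 2 :=
  (abs_dotProduct_mulVec_le H x x).trans (le_of_eq (by ring))

theorem continuous_quadValue :
    Continuous fun p : Matrix (Fin d) (Fin d) ℝ × (Fin d → ℝ) => quadValue p.1 p.2 := by
  unfold quadValue
  fun_prop

/-- Positive definite forms are coercive, locally uniformly in the form. -/
theorem exists_eventually_le_quadValue {Q : Matrix (Fin d) (Fin d) ℝ} (hQ : Q.PosDef) :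
    ∃ c > 0, ∀ᶠ R in 𝓝 Q, ∀ x, c * ‖x‖ ^ 2 ≤ quadValue R x := by
  obtain ⟨a, ha, hmin⟩ := (isCompact_sphere (0 : Fin d → ℝ) 1).exists_forall_le'
    (f := fun x => quadValue Q x)
    (continuous_quadValue.comp (Continuous.prodMk_right Q)).continuousOn (a := 0)
    (fun x hx => quadValue_pos hQ (by rintro rfl; simp at hx))
  have hbound : ∀ x, a * ‖x‖ ^ 2 ≤ quadValue Q x := fun x => by
    by_cases hx : x = 0
    · simp [hx, quadValue]
    have hxn : 0 < ‖x‖ := norm_pos_iff.mpr hx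
    have := hmin (‖x‖⁻¹ • x) (by simp [norm_smul, hxn.ne'])
    rw [quadValue_smul_right, inv_pow, ← div_eq_inv_mul, le_div_iff₀ (by positivity)] at this
    exact this
  refine ⟨a / 2, by positivity, ?_⟩
  have hball : ∀ᶠ R in 𝓝 Q, ‖R - Q‖ < a / (2 * (d ^ 2 + 1)) := by
    have : Tendsto (fun R => ‖R - Q‖) (𝓝 Q) (𝓝 0) := by
      have : Continuous fun R : Matrix (Fin d) (Fin d) ℝ => ‖R - Q‖ := by fun_prop
      simpa using this.tendsto Q
    exact this.eventually_lt_const (by positivity)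
  filter_upwards [hball] with R hR x
  have h1 := abs_le.mp (abs_quadValue_le (R - Q) x)
  have h2 : quadValue R x = quadValue Q x + quadValue (R - Q) x := by
    rw [← quadValue_add_left, add_sub_cancel]
  have h3 : (d : ℝ) ^ 2 * ‖R - Q‖ ≤ a / 2 := by
    rw [lt_div_iff₀ (by positivity)] at hR
    nlinarith [norm_nonneg (R - Q)]
  have := mul_le_mul_of_nonneg_right h3 (sq_nonneg ‖x‖)
  linarith [hbound x]

end QuadraticForms

/-! ### Gaps and the arithmetical minimum: local finiteness and continuity. -/

section Forms

variable {d k : ℕ}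

/-- The value of the form on the difference of the points `t_i` and `t_j + v`. -/
def gapValue (X : FormSpace d k) (i j : Fin (k + 1)) (v : Fin d → ℤ) : ℝ :=
  quadValue X.1 (translation X i - translation X j - intVec v)

theorem intVec_injective : Function.Injective (intVec (d := d)) := fun u v h => by
  ext a; exact Int.cast_injective (congrFun h a)

theorem intVec_sub (u v : Fin d → ℤ) : intVec (u - v) = intVec u - intVec v := by
  ext; simp [intVec]

@[simp] theorem intVec_zero : intVec (0 : Fin d → ℤ) = 0 := by
  ext; simp [intVec]

@[simp] theorem translation_castSucc (X : FormSpace d k) (i : Fin k) :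
    translation X i.castSucc = X.2 i := by
  simp [translation]

@[simp] theorem translation_last (X : FormSpace d k) : translation X (Fin.last k) = 0 := by
  simp [translation]

theorem translation_add (X Y : FormSpace d k) (i : Fin (k + 1)) :
    translation (X + Y) i = translation X i + translation Y i := by
  induction i using Fin.lastCases <;> simp

theorem translation_smul (c : ℝ) (X : FormSpace d k) (i : Fin (k + 1)) :
    translation (c • X) i = c • translation X i := by
  induction i using Fin.lastCases <;> simp

theorem translation_congr {X Y : FormSpace d k} (h : X.2 = Y.2) :
    translation X = translation Y := by
  simp [translation, h]

theorem norm_translation_le (X : FormSpace d k) (i : Fin (k + 1)) :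
    ‖translation X i‖ ≤ ‖X.2‖ := by
  induction i using Fin.lastCases with
  | last => simp
  | cast i => simpa using norm_le_pi_norm X.2 i

theorem continuous_translation (i : Fin (k + 1)) :
    Continuous fun X : FormSpace d k => translation X i := by
  induction i using Fin.lastCases with
  | last => simpa using continuous_const
  | cast i =>
    simp only [translation_castSucc]
    fun_prop

theorem continuous_gapValue (i j : Fin (k + 1)) (v : Fin d → ℤ) :
    Continuous fun X : FormSpace d k => gapValue X i j v :=
  continuous_quadValue.comp (continuous_fst.prodMk
    (((continuous_translation i).sub (continuous_translation j)).sub continuous_const))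

/-- Near a periodic form, only finitely many gaps can have bounded value. -/
theorem exists_finite_eventually_lt_gapValue {X : FormSpace d k} (hX : X ∈ periodicForms d k)
    (M : ℝ) : ∃ F : Set (Fin (k + 1) × Fin (k + 1) × (Fin d → ℤ)), F.Finite ∧
      ∀ᶠ Y in 𝓝 X, ∀ i j v, (i, j, v) ∉ F → M < gapValue Y i j v := by
  obtain ⟨c, hc, hcoer⟩ := exists_eventually_le_quadValue hX
  -- Chosen so that `c * r > |M|` and `r ≥ 1`, whence `c * r ^ 2 > M`. In `R`, the term `2 * (‖X.2‖
  -- + 1)` bounds the difference of two translations of a nearby form.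
  set r : ℝ := |M| / c + 1
  set R : ℝ := 2 * (‖X.2‖ + 1) + r
  refine ⟨{p | ‖intVec p.2.2‖ ≤ R}, ?_, ?_⟩
  · have hfin : {v : Fin d → ℤ | ‖intVec v‖ ≤ R}.Finite := by
      refine (Set.finite_Icc (fun _ => -⌈R⌉ : Fin d → ℤ) (fun _ => ⌈R⌉)).subset fun v hv => ?_
      have h1 : ∀ a, |(v a : ℝ)| ≤ ⌈R⌉ := fun a =>
        ((norm_le_pi_norm (intVec v) a).trans hv).trans (Int.le_ceil R)
      have h2 : ∀ a, |v a| ≤ ⌈R⌉ := fun a => by exact_mod_cast h1 a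
      exact ⟨fun a => (abs_le.mp (h2 a)).1, fun a => (abs_le.mp (h2 a)).2⟩
    refine (Set.finite_univ.prod (Set.finite_univ.prod hfin)).subset ?_
    rintro ⟨i, j, v⟩ h
    exact ⟨trivial, trivial, h⟩
  · have h1 : ∀ᶠ Y : FormSpace d k in 𝓝 X, ‖Y.2‖ < ‖X.2‖ + 1 :=
      (continuous_snd.norm.tendsto X).eventually_lt_const (by linarith)
    have h2 := (continuous_fst.tendsto X).eventually hcoer
    filter_upwards [h1, h2] with Y hY hcY i j v hv
    have hv' : R < ‖intVec v‖ := not_le.mp hv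
    have hlow : r ≤ ‖translation Y i - translation Y j - intVec v‖ := by
      have e1 := norm_sub_norm_le (intVec v) (translation Y i - translation Y j)
      rw [norm_sub_rev (intVec v)] at e1
      have e2 := norm_sub_le (translation Y i) (translation Y j)
      have e3 := norm_translation_le Y i
      have e4 := norm_translation_le Y j
      linarith
    have hr1 : 1 ≤ r := le_add_of_nonneg_left (by positivity)
    have hr2 : c * r = |M| + c := by simp only [r]; field_simp
    have hr3 : r ≤ ‖translation Y i - translation Y j - intVec v‖ ^ 2 := by nlinarith
    calc M ≤ |M| := le_abs_self M
      _ < c * r := by linarith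
      _ ≤ _ := mul_le_mul_of_nonneg_left hr3 hc.le
      _ ≤ _ := hcY _

theorem finite_gapValue_le {X : FormSpace d k} (hX : X ∈ periodicForms d k) (M : ℝ) :
    {p : Fin (k + 1) × Fin (k + 1) × (Fin d → ℤ) | gapValue X p.1 p.2.1 p.2.2 ≤ M}.Finite := by
  obtain ⟨F, hF, hev⟩ := exists_finite_eventually_lt_gapValue hX M
  refine hF.subset fun p hp => ?_
  by_contra hpF
  exact absurd (hev.self_of_nhds p.1 p.2.1 p.2.2 hpF) (not_lt.mpr hp)

/-- One neighbourhood serves all infinitely many gaps: only a finite set needs continuity, and the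
rest are large automatically. -/
theorem eventually_lt_gapValue {X : FormSpace d k} (hX : X ∈ periodicForms d k) (M : ℝ) :
    ∀ᶠ Y in 𝓝 X, ∀ i j v, M < gapValue X i j v → M < gapValue Y i j v := by
  obtain ⟨F, hF, hev⟩ := exists_finite_eventually_lt_gapValue hX M
  have h : ∀ p ∈ F, ∀ᶠ Y in 𝓝 X, M < gapValue X p.1 p.2.1 p.2.2 →
      M < gapValue Y p.1 p.2.1 p.2.2 := fun p _ => by
    by_cases hp : M < gapValue X p.1 p.2.1 p.2.2
    · filter_upwards [((continuous_gapValue p.1 p.2.1 p.2.2).tendsto X).eventually_const_lt hp]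
        with Y hY _ using hY
    · exact .of_forall fun Y h => absurd h hp
  filter_upwards [hev, (eventually_all_finite hF).mpr h] with Y h1 h2 i j v hlt
  by_cases hm : (i, j, v) ∈ F
  · exact h2 _ hm hlt
  · exact h1 i j v hm

theorem bddBelow_gapValue {X : FormSpace d k} (hX : X ∈ periodicForms d k) :
    BddBelow {r | ∃ (i j : Fin (k + 1)) (v : Fin d → ℤ), (i = j → v ≠ 0) ∧
      r = quadValue X.1 (translation X i - translation X j - intVec v)} :=
  ⟨0, by rintro _ ⟨i, j, v, -, rfl⟩; exact quadValue_nonneg hX _⟩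

theorem arithMin_le {X : FormSpace d k} (hX : X ∈ periodicForms d k) {i j : Fin (k + 1)}
    {v : Fin d → ℤ} (h : i = j → v ≠ 0) : arithMin X ≤ gapValue X i j v :=
  csInf_le (bddBelow_gapValue hX) ⟨i, j, v, h, rfl⟩

theorem exists_int_ne_zero (hd : 0 < d) : ∃ v : Fin d → ℤ, v ≠ 0 :=
  ⟨fun _ => 1, fun h => by simpa using congrFun h ⟨0, hd⟩⟩

theorem le_arithMin (hd : 0 < d) {X : FormSpace d k} {a : ℝ}
    (h : ∀ i j v, (i = j → v ≠ 0) → a ≤ gapValue X i j v) : a ≤ arithMin X := by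
  obtain ⟨v, hv⟩ := exists_int_ne_zero hd
  refine le_csInf ⟨_, 0, 0, v, fun _ => hv, rfl⟩ ?_
  rintro _ ⟨i, j, v, hv, rfl⟩
  exact h i j v hv

theorem exists_gapValue_eq_arithMin (hd : 0 < d) {X : FormSpace d k}
    (hX : X ∈ periodicForms d k) :
    ∃ i j v, (i = j → v ≠ 0) ∧ gapValue X i j v = arithMin X := by
  obtain ⟨v, hv⟩ := exists_int_ne_zero hd
  set M := gapValue X 0 0 v
  set T := {p : Fin (k + 1) × Fin (k + 1) × (Fin d → ℤ) |
    (p.1 = p.2.1 → p.2.2 ≠ 0) ∧ gapValue X p.1 p.2.1 p.2.2 ≤ M}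
  have hT : T.Finite := (finite_gapValue_le hX M).subset fun p hp => hp.2
  obtain ⟨p, hp, hmin⟩ := hT.exists_minimalFor (fun p => gapValue X p.1 p.2.1 p.2.2) T
    ⟨(0, 0, v), fun _ => hv, le_rfl⟩
  refine ⟨p.1, p.2.1, p.2.2, hp.1, le_antisymm (le_arithMin hd fun i j w hw => ?_)
    (arithMin_le hX hp.1)⟩
  rcases le_total (gapValue X p.1 p.2.1 p.2.2) (gapValue X i j w) with h | h
  · exact h
  · exact hmin (j := (i, j, w)) ⟨hw, h.trans hp.2⟩ h

/-- The translations `t_i` are pairwise incongruent modulo `ℤ^d`. -/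
def Incongruent (X : FormSpace d k) : Prop :=
  ∀ i j : Fin (k + 1), i ≠ j → ∀ v : Fin d → ℤ, translation X i - translation X j ≠ intVec v

theorem Incongruent.gap_ne_zero {X : FormSpace d k} (h : Incongruent X) {i j : Fin (k + 1)}
    {v : Fin d → ℤ} (hv : i = j → v ≠ 0) : translation X i - translation X j - intVec v ≠ 0 := by
  intro h0
  by_cases hij : i = j
  · subst hij
    rw [sub_self, zero_sub, neg_eq_zero, ← intVec_zero] at h0
    exact hv rfl (intVec_injective h0)
  · exact h i j hij v (sub_eq_zero.mp h0)

theorem arithMin_pos (hd : 0 < d) {X : FormSpace d k} (hX : X ∈ periodicForms d k)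
    (h : Incongruent X) : 0 < arithMin X := by
  obtain ⟨i, j, v, hv, heq⟩ := exists_gapValue_eq_arithMin hd hX
  rw [← heq]
  exact quadValue_pos hX (h.gap_ne_zero hv)

theorem incongruent_of_arithMin_pos {X : FormSpace d k} (hX : X ∈ periodicForms d k)
    (h : 0 < arithMin X) : Incongruent X := fun i j hij v h0 => by
  have := arithMin_le hX (i := i) (j := j) (v := v) fun h => absurd h hij
  rw [gapValue, h0, sub_self] at this
  simp [quadValue] at this
  linarith

theorem arithMin_nonneg (hd : 0 < d) {X : FormSpace d k} (hX : X ∈ periodicForms d k) :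
    0 ≤ arithMin X :=
  le_arithMin hd fun _ _ _ _ => quadValue_nonneg hX _

/-- Lower semicontinuity needs the uniformity of `eventually_lt_gapValue`; for the upper bound it
suffices to follow a single minimal gap. -/
theorem tendsto_arithMin (hd : 0 < d) {X : FormSpace d k} (hX : X ∈ periodicForms d k) :
    Tendsto arithMin (𝓝[periodicForms d k] X) (𝓝 (arithMin X)) := by
  refine tendsto_order.mpr ⟨fun a ha => ?_, fun a ha => ?_⟩
  · obtain ⟨b, hab, hb⟩ := exists_between ha
    filter_upwards [nhdsWithin_le_nhds (eventually_lt_gapValue hX b)] with Y hY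
    exact hab.trans_le (le_arithMin hd fun i j v hv => (hY i j v (hb.trans_le
      (arithMin_le hX hv))).le)
  · obtain ⟨i, j, v, hv, heq⟩ := exists_gapValue_eq_arithMin hd hX
    have := ((continuous_gapValue i j v).tendsto X).eventually_lt_const (heq ▸ ha)
    filter_upwards [nhdsWithin_le_nhds this, self_mem_nhdsWithin] with Y hY hYp
    exact (arithMin_le hYp hv).trans_lt hY

theorem arithMin_smul (hd : 0 < d) {X : FormSpace d k} (hX : X ∈ periodicForms d k) {c : ℝ}
    (hc : 0 < c) : arithMin ((c • X.1, X.2) : FormSpace d k) = c * arithMin X := by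
  have hval : ∀ i j v, gapValue ((c • X.1, X.2) : FormSpace d k) i j v = c * gapValue X i j v :=
    fun i j v => by
      rw [gapValue, gapValue, quadValue_smul_left,
        translation_congr (X := ((c • X.1, X.2) : FormSpace d k)) (Y := X) rfl]
  have hcX : ((c • X.1, X.2) : FormSpace d k) ∈ periodicForms d k := hX.smul hc
  apply le_antisymm
  · obtain ⟨i, j, v, hv, heq⟩ := exists_gapValue_eq_arithMin hd hX
    rw [← heq, ← hval]
    exact arithMin_le hcX hv
  · refine le_arithMin hd fun i j v hv => ?_
    rw [hval]
    exact mul_le_mul_of_nonneg_left (arithMin_le hX hv) hc.le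

/-! ### Comparing densities; scale invariance. -/

section Density

theorem density_lt_density_iff (hd : 0 < d) {X Y : FormSpace d k} (hX : X ∈ periodicForms d k)
    (hY : Y ∈ periodicForms d k) :
    density Y < density X ↔
      arithMin Y / Y.1.det ^ (1 / (d : ℝ)) < arithMin X / X.1.det ^ (1 / (d : ℝ)) := by
  have hvol : 0 < (volume (Metric.ball (0 : EuclideanSpace ℝ (Fin d)) 1)).toReal :=
    ENNReal.toReal_pos (Metric.measure_ball_pos _ _ one_pos).ne' measure_ball_lt_top.ne
  have hd' : (0 : ℝ) < d := by exact_mod_cast hd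
  have hX0 : 0 ≤ arithMin X / X.1.det ^ (1 / (d : ℝ)) :=
    div_nonneg (arithMin_nonneg hd hX) (Real.rpow_nonneg hX.det_pos.le _)
  have hY0 : 0 ≤ arithMin Y / Y.1.det ^ (1 / (d : ℝ)) :=
    div_nonneg (arithMin_nonneg hd hY) (Real.rpow_nonneg hY.det_pos.le _)
  unfold density
  rw [div_lt_div_iff_of_pos_right (by positivity), mul_lt_mul_iff_left₀ hvol,
    mul_lt_mul_iff_left₀ (by positivity), Real.rpow_lt_rpow_iff hY0 hX0 (by positivity)]

theorem density_lt_density_of_det_lt (hd : 0 < d) {X Y : FormSpace d k}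
    (hX : X ∈ periodicForms d k) (hY : Y ∈ periodicForms d k) (hpos : 0 < arithMin X)
    (hle : arithMin Y ≤ arithMin X) (hdet : X.1.det < Y.1.det) : density Y < density X := by
  rw [density_lt_density_iff hd hX hY]
  have hX' := hX.det_pos
  calc arithMin Y / Y.1.det ^ (1 / (d : ℝ)) ≤ arithMin X / Y.1.det ^ (1 / (d : ℝ)) :=
        div_le_div_of_nonneg_right hle (Real.rpow_nonneg hY.det_pos.le _)
    _ < _ := div_lt_div_of_pos_left hpos (Real.rpow_pos_of_pos hX' _)
        (Real.rpow_lt_rpow hX'.le hdet (by positivity))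

theorem density_le_density_of_det_eq (hd : 0 < d) {X Y : FormSpace d k}
    (hX : X ∈ periodicForms d k) (hY : Y ∈ periodicForms d k)
    (hle : arithMin Y ≤ arithMin X) (hdet : X.1.det = Y.1.det) : density Y ≤ density X := by
  rw [← not_lt, density_lt_density_iff hd hY hX, hdet, not_lt]
  exact div_le_div_of_nonneg_right hle (Real.rpow_nonneg hY.det_pos.le _)

theorem density_smul (hd : 0 < d) {X : FormSpace d k} (hX : X ∈ periodicForms d k) {c : ℝ}
    (hc : 0 < c) : density ((c • X.1, X.2) : FormSpace d k) = density X := by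
  have hd' : (d : ℝ) ≠ 0 := by exact_mod_cast hd.ne'
  have : (c • X.1).det ^ (1 / (d : ℝ)) = c * X.1.det ^ (1 / (d : ℝ)) := by
    rw [Matrix.det_smul, Fintype.card_fin, Real.mul_rpow (by positivity) hX.det_pos.le,
      ← Real.rpow_natCast, ← Real.rpow_mul hc.le, mul_one_div_cancel hd', Real.rpow_one]
  unfold density
  rw [arithMin_smul hd hX hc]
  dsimp only
  rw [this, mul_div_mul_left _ _ hc.ne']

/-- Rescaling a nearby form to the arithmetical minimum of an isolated extreme form: nearby forms
have no larger density, and those of the same density are multiples. -/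
theorem IsIsolatedMExtreme.eventually_of_le (hd : 0 < d) {X : FormSpace d k}
    (h : IsIsolatedMExtreme X) (hpos : 0 < arithMin X) :
    ∀ᶠ Y in 𝓝[periodicForms d k] X, density Y ≤ density X ∧
      (density X ≤ density Y → Y.2 = X.2) := by
  obtain ⟨hX, hiso⟩ := h
  have hlim := tendsto_arithMin hd hX
  -- Rescaling to minimum `λ(X)` keeps the density and, as `λ` is continuous, stays near `X`;
  -- isolation applies to the rescaled form.
  have hscale : Tendsto (fun Y : FormSpace d k =>
      (((arithMin X / arithMin Y) • Y.1, Y.2) : FormSpace d k))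
      (𝓝[periodicForms d k] X) (𝓝[periodicForms d k] X) := by
    refine tendsto_nhdsWithin_iff.mpr ⟨?_, ?_⟩
    · have h1 : Tendsto (fun Y : FormSpace d k => arithMin X / arithMin Y)
          (𝓝[periodicForms d k] X) (𝓝 1) := by
        rw [← div_self hpos.ne']
        exact tendsto_const_nhds.div hlim hpos.ne'
      have h2 : Tendsto (fun Y : FormSpace d k => Y.1) (𝓝[periodicForms d k] X) (𝓝 X.1) :=
        (continuous_fst.tendsto X).mono_left nhdsWithin_le_nhds
      have h3 : Tendsto (fun Y : FormSpace d k => Y.2) (𝓝[periodicForms d k] X) (𝓝 X.2) :=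
        (continuous_snd.tendsto X).mono_left nhdsWithin_le_nhds
      simpa using (h1.smul h2).prodMk_nhds h3
    · filter_upwards [hlim.eventually_const_lt hpos, self_mem_nhdsWithin] with Y hYpos hY
      exact Matrix.PosDef.smul hY (div_pos hpos hYpos)
  filter_upwards [hscale.eventually hiso, hlim.eventually_const_lt hpos, self_mem_nhdsWithin]
    with Y hYiso hYpos hY
  have hc : 0 < arithMin X / arithMin Y := div_pos hpos hYpos
  rw [density_smul hd hY hc, arithMin_smul hd hY hc, div_mul_cancel₀ _ hYpos.ne'] at hYiso
  by_cases heq : (((arithMin X / arithMin Y) • Y.1, Y.2) : FormSpace d k) = X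
  · refine ⟨?_, fun _ => by have := congrArg Prod.snd heq; exact this⟩
    conv_rhs => rw [← heq]
    exact (density_smul hd hY hc).ge
  · have := hYiso heq rfl
    exact ⟨this.le, fun h => absurd h this.not_ge⟩

end Density

end Forms

/-! ### Rigid contacts imply isolated extremality. -/

section Isolated

variable {d k : ℕ}

theorem abs_trace_mul_le (M H : Matrix (Fin d) (Fin d) ℝ) :
    |(M * H).trace| ≤ d ^ 2 * ‖M‖ * ‖H‖ := by
  have h1 : ∀ i, |(M * H) i i| ≤ d * (‖M‖ * ‖H‖) := fun i => by
    rw [Matrix.mul_apply]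
    refine (Finset.abs_sum_le_sum_abs _ _).trans ?_
    refine (Finset.sum_le_card_nsmul _ _ (‖M‖ * ‖H‖) fun j _ => ?_).trans (by simp)
    rw [abs_mul]
    exact mul_le_mul (Matrix.norm_entry_le_entrywise_sup_norm M)
      (Matrix.norm_entry_le_entrywise_sup_norm H) (abs_nonneg _) (norm_nonneg _)
  refine (Finset.abs_sum_le_sum_abs (fun i => (M * H) i i) Finset.univ).trans ?_
  refine (Finset.sum_le_card_nsmul _ _ _ fun i _ => h1 i).trans (le_of_eq ?_)
  simp; ring

theorem tendsto_matrix_inv {Q : Matrix (Fin d) (Fin d) ℝ} (hQ : Q.det ≠ 0) :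
    Tendsto (fun R : Matrix (Fin d) (Fin d) ℝ => R⁻¹) (𝓝 Q) (𝓝 Q⁻¹) := by
  simp only [Matrix.inv_def, Ring.inverse_eq_inv']
  have h1 : Tendsto (fun R : Matrix (Fin d) (Fin d) ℝ => R.det) (𝓝 Q) (𝓝 Q.det) :=
    (continuous_id.matrix_det).tendsto Q
  have h2 : Tendsto (fun R : Matrix (Fin d) (Fin d) ℝ => R.adjugate) (𝓝 Q) (𝓝 Q.adjugate) :=
    (continuous_id.matrix_adjugate).tendsto Q
  exact (h1.inv₀ hQ).smul h2

/-- Both conclusions of Voronoi's theorem on extreme forms, perfection and eutaxy, in dual form,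
for the set `W` of minimal vectors of `Q`. -/
def VoronoiRigid (Q : Matrix (Fin d) (Fin d) ℝ) (W : Set (Fin d → ℝ)) : Prop :=
  ∀ H : Matrix (Fin d) (Fin d) ℝ, Hᵀ = H → (∀ w ∈ W, 0 ≤ quadValue H w) →
    (Q⁻¹ * H).trace ≤ 0 → H = 0

/-- Quantitative rigidity by compactness. It tolerates a slightly positive trace, needed because the
determinant comparison yields the trace against the inverse of the perturbed form, not against
`Q⁻¹`. -/
theorem VoronoiRigid.exists_pos {Q : Matrix (Fin d) (Fin d) ℝ} {W : Set (Fin d → ℝ)}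
    (hW : W.Finite) (h : VoronoiRigid Q W) :
    ∃ c > 0, ∀ H : Matrix (Fin d) (Fin d) ℝ, Hᵀ = H → H ≠ 0 →
      (Q⁻¹ * H).trace < c * ‖H‖ → ∃ w ∈ W, quadValue H w ≤ -(c * ‖H‖) := by
  have := hW.to_subtype
  -- The index `none` carries the extra functional `-tr (Q⁻¹H)`.
  let f : Option W → Matrix (Fin d) (Fin d) ℝ →ₗ[ℝ] ℝ := fun o => o.elim
    { toFun := fun H => -(Q⁻¹ * H).trace
      map_add' := fun H K => by simp [Matrix.mul_add]; ring
      map_smul' := fun c H => by simp }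
    (fun w =>
      { toFun := fun H => quadValue H w
        map_add' := fun H K => quadValue_add_left H K w
        map_smul' := fun c H => quadValue_smul_left c H w })
  obtain ⟨c, hc, hneg⟩ := exists_le_neg_mul_norm f
    (S := {H : Matrix (Fin d) (Fin d) ℝ | Hᵀ = H})
    (isClosed_eq continuous_id.matrix_transpose continuous_id)
    (fun c H hH => by
      change (c • H)ᵀ = c • H
      rw [Matrix.transpose_smul, show Hᵀ = H from hH])
    (fun H hH hf => h H hH (fun w hw => hf (some ⟨w, hw⟩)) (neg_nonneg.mp (hf none)))
  refine ⟨c, hc, fun H hH hne hlt => ?_⟩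
  obtain ⟨o, ho⟩ := hneg H hH hne
  cases o with
  | none => exact absurd (neg_le_neg_iff.mp ho) (not_le.mpr hlt)
  | some w => exact ⟨w, w.2, ho⟩

/-- The change of the contact vectors `w` under a motion `n` of the translates, measured along
`w`, where `σ w` sends each translate to its neighbour in direction `w`. -/
def contactMap (Q : Matrix (Fin d) (Fin d) ℝ) (w : Fin d → ℝ) (i j : Fin (k + 1)) :
    (Fin k → Fin d → ℝ) →ₗ[ℝ] ℝ where
  toFun n := w ⬝ᵥ Q *ᵥ (translation ((0, n) : FormSpace d k) i -
    translation ((0, n) : FormSpace d k) j)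
  map_add' n n' := by
    have : ((0, n + n') : FormSpace d k) = (0, n) + (0, n') := by simp
    rw [this, translation_add, translation_add, ← dotProduct_add, ← Matrix.mulVec_add]
    congr 2; abel
  map_smul' c n := by
    have : ((0, c • n) : FormSpace d k) = c • ((0, n) : FormSpace d k) := by simp
    rw [this, translation_smul, translation_smul, ← smul_sub, Matrix.mulVec_smul, dotProduct_smul]
    rfl

theorem sum_contactMap (Q : Matrix (Fin d) (Fin d) ℝ) (w : Fin d → ℝ)
    (σ : Equiv.Perm (Fin (k + 1))) (n : Fin k → Fin d → ℝ) :
    ∑ i, contactMap Q w i (σ i) n = 0 := by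
  simp only [contactMap, LinearMap.coe_mk, AddHom.coe_mk, Matrix.mulVec_sub, dotProduct_sub,
    Finset.sum_sub_distrib]
  rw [Equiv.sum_comp σ fun i => w ⬝ᵥ Q *ᵥ translation ((0, n) : FormSpace d k) i, sub_self]

/-- For fixed `w` the contact changes sum to zero, so if none is negative all vanish. This turns the
hypothesis on equalities into the one-sided statement that compactness requires. -/
theorem exists_contactMap_le {Q : Matrix (Fin d) (Fin d) ℝ} {W : Set (Fin d → ℝ)}
    (hW : W.Finite) (σ : (Fin d → ℝ) → Equiv.Perm (Fin (k + 1)))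
    (h : ∀ n : Fin k → Fin d → ℝ, (∀ w ∈ W, ∀ i, contactMap Q w i (σ w i) n = 0) → n = 0) :
    ∃ c > 0, ∀ n : Fin k → Fin d → ℝ, n ≠ 0 →
      ∃ w ∈ W, ∃ i, contactMap Q w i (σ w i) n ≤ -(c * ‖n‖) := by
  have := hW.to_subtype
  obtain ⟨c, hc, hneg⟩ := exists_le_neg_mul_norm
    (fun p : W × Fin (k + 1) => contactMap Q (p.1 : Fin d → ℝ) p.2 (σ p.1 p.2)) isClosed_univ
    (fun _ _ _ => trivial) (fun n _ hn => h n fun w hw i =>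
      (Finset.sum_eq_zero_iff_of_nonneg fun j _ => hn (⟨w, hw⟩, j)).mp
        (sum_contactMap Q w (σ w) n) i (Finset.mem_univ i))
  exact ⟨c, hc, fun n hn => let ⟨p, hp⟩ := hneg n trivial hn; ⟨p.1, p.1.2, p.2, hp⟩⟩

/-- A periodic form whose contacts rigidify both the matrix and the translates is isolated
extreme. -/
theorem isIsolatedMExtreme_of_rigid (hd : 0 < d) {X : FormSpace d k} (hX : X ∈ periodicForms d k)
    (hpos : 0 < arithMin X) {W : Set (Fin d → ℝ)} (hW : W.Finite)
    (hmin : ∀ w ∈ W, quadValue X.1 w = arithMin X) (σ : (Fin d → ℝ) → Equiv.Perm (Fin (k + 1)))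
    (hσ : ∀ w ∈ W, ∀ i, ∃ v : Fin d → ℤ, (i = σ w i → v ≠ 0) ∧
      translation X i - translation X (σ w i) - intVec v = w)
    (hV : VoronoiRigid X.1 W)
    (hN : ∀ n : Fin k → Fin d → ℝ, (∀ w ∈ W, ∀ i, contactMap X.1 w i (σ w i) n = 0) → n = 0) :
    IsIsolatedMExtreme X := by
  refine ⟨hX, ?_⟩
  obtain ⟨c₁, hc₁, hneg₁⟩ := hV.exists_pos hW
  obtain ⟨c₂, hc₂, hneg₂⟩ := exists_contactMap_le hW σ hN
  obtain ⟨r, hr⟩ := (hW.image fun w => ‖w‖).bddAbove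
  replace hr : ∀ w ∈ W, ‖w‖ ≤ max r 0 := fun w hw => (hr ⟨w, hw, rfl⟩).trans (le_max_left _ _)
  generalize max r 0 = r at hr
  -- `B * ‖n‖ ^ 2` bounds `Y[D]`, where `‖D‖ ≤ 2 * ‖n‖`. The constant `K` below collects all
  -- quadratic terms: `H[w]`, `2 wᵀHD` and `Y[D]`, once `‖H‖ ≤ B / c₁ * ‖n‖ ^ 2` is known.
  set B : ℝ := 4 * (d ^ 2 * (‖X.1‖ + 1)) with hB
  have hB0 : 0 ≤ B := by positivity
  set K : ℝ := (d ^ 2 * |r| ^ 2 + 4 * d ^ 2 * |r|) * (B / c₁) + B with hK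
  have hK0 : 0 ≤ K := by positivity
  have ev1 : ∀ᶠ Y in 𝓝 X, ‖Y.1 - X.1‖ < 1 := by
    have : Continuous fun Y : FormSpace d k => ‖Y.1 - X.1‖ := by fun_prop
    exact (this.tendsto X).eventually_lt_const (by simp)
  have ev2 : ∀ᶠ Y in 𝓝 X, ‖Y.2 - X.2‖ < min 1 (c₂ / (K + 1)) := by
    have : Continuous fun Y : FormSpace d k => ‖Y.2 - X.2‖ := by fun_prop
    refine (this.tendsto X).eventually_lt_const ?_
    simp only [sub_self, norm_zero]
    positivity
  have ev3 : ∀ᶠ Y in 𝓝 X, ‖X.1⁻¹ - Y.1⁻¹‖ < c₁ / (d ^ 2 + 1) := by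
    have h1 : Tendsto (fun Y : FormSpace d k => Y.1⁻¹) (𝓝 X) (𝓝 X.1⁻¹) :=
      (tendsto_matrix_inv hX.det_pos.ne').comp (continuous_fst.tendsto X)
    have h2 := (tendsto_const_nhds (x := X.1⁻¹)).sub h1
    refine h2.norm.eventually_lt_const ?_
    simp only [sub_self, norm_zero]
    positivity
  filter_upwards [nhdsWithin_le_nhds ev1, nhdsWithin_le_nhds ev2, nhdsWithin_le_nhds ev3,
    self_mem_nhdsWithin] with Y hY1 hY2 hY3 hY hne heq
  by_contra hdens
  have hdet : Y.1.det ≤ X.1.det := by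
    by_contra! hlt
    exact hdens (density_lt_density_of_det_lt hd hX hY hpos heq.le hlt)
  set H := Y.1 - X.1 with hH
  set n := Y.2 - X.2 with hn
  have hYQ : Y.1 = X.1 + H := by simp [hH]
  have hXt : X.1ᵀ = X.1 := by
    simpa [Matrix.conjTranspose_eq_transpose_of_trivial] using hX.isHermitian.eq
  have hYt : Y.1ᵀ = Y.1 := by
    simpa [Matrix.conjTranspose_eq_transpose_of_trivial] using hY.isHermitian.eq
  have hHt : Hᵀ = H := by rw [hH, Matrix.transpose_sub, hXt, hYt]
  set D : (Fin d → ℝ) → Fin (k + 1) → Fin d → ℝ := fun w i =>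
    translation ((0, n) : FormSpace d k) i - translation ((0, n) : FormSpace d k) (σ w i) with hD
  have hDn : ∀ w i, ‖D w i‖ ≤ 2 * ‖n‖ := fun w i => by
    have h1 := norm_translation_le ((0, n) : FormSpace d k) i
    have h2 := norm_translation_le ((0, n) : FormSpace d k) (σ w i)
    exact (norm_sub_le _ _).trans (by dsimp only at h1 h2; linarith)
  have htrans : ∀ i, translation Y i = translation X i + translation ((0, n) : FormSpace d k) i :=
    fun i => by
      rw [← translation_add]
      exact congrFun (translation_congr (by simp [hn])) i
  have hQD : ∀ w i, quadValue Y.1 (D w i) ≤ B * ‖n‖ ^ 2 := fun w i => by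
    have h1 := (le_abs_self _).trans (abs_quadValue_le Y.1 (D w i))
    have h2 : ‖Y.1‖ ≤ ‖X.1‖ + 1 := by
      rw [hYQ]
      exact (norm_add_le _ _).trans (by linarith)
    have h3 : ‖D w i‖ ^ 2 ≤ (2 * ‖n‖) ^ 2 := pow_le_pow_left₀ (norm_nonneg _) (hDn w i) 2
    calc _ ≤ _ := h1
      _ ≤ d ^ 2 * (‖X.1‖ + 1) * (2 * ‖n‖) ^ 2 := by gcongr
      _ = B * ‖n‖ ^ 2 := by rw [hB]; ring
  have hlen : ∀ w ∈ W, ∀ i, 0 ≤ quadValue H w + 2 * contactMap X.1 w i (σ w i) n +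
      2 * (w ⬝ᵥ H *ᵥ D w i) + quadValue Y.1 (D w i) := fun w hw i => by
    obtain ⟨v, hv, hvw⟩ := hσ w hw i
    have h1 := arithMin_le hY hv
    have h2 : translation Y i - translation Y (σ w i) - intVec v = w + D w i := by
      simp only [htrans, hD]; linear_combination hvw
    have h3 : w ⬝ᵥ Y.1 *ᵥ D w i = contactMap X.1 w i (σ w i) n + w ⬝ᵥ H *ᵥ D w i := by
      rw [hYQ, Matrix.add_mulVec, dotProduct_add]; rfl
    have h4 : quadValue Y.1 w = arithMin X + quadValue H w := by
      rw [hYQ, quadValue_add_left, hmin w hw]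
    rw [gapValue, h2, quadValue_add_right hYt, h3, h4, heq] at h1
    linarith
  -- Sum over all translates: both terms linear in `D` cancel, as `σ w` is a permutation.
  have hHw : ∀ w ∈ W, -(B * ‖n‖ ^ 2) ≤ quadValue H w := fun w hw => by
    have h1 := Finset.sum_nonneg fun i (_ : i ∈ Finset.univ) => hlen w hw i
    simp only [Finset.sum_add_distrib, ← Finset.mul_sum] at h1
    have h2 : ∑ i, w ⬝ᵥ H *ᵥ D w i = 0 := sum_contactMap H w (σ w) n
    have h3 := Finset.sum_le_card_nsmul Finset.univ _ _ fun i _ => hQD w i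
    rw [sum_contactMap, h2, Finset.sum_const] at h1
    simp only [Finset.card_univ, Fintype.card_fin, nsmul_eq_mul] at h1 h3
    have hk : (0 : ℝ) < ((k + 1 : ℕ) : ℝ) := by positivity
    have h4 : 0 ≤ ((k + 1 : ℕ) : ℝ) * (quadValue H w + B * ‖n‖ ^ 2) := by linarith
    have := nonneg_of_mul_nonneg_right h4 hk
    linarith
  have hHn : ‖H‖ ≤ B / c₁ * ‖n‖ ^ 2 := by
    by_cases hH0 : H = 0
    · rw [hH0, norm_zero]; positivity
    have hHpos : 0 < ‖H‖ := norm_pos_iff.mpr hH0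
    have htr : (X.1⁻¹ * H).trace < c₁ * ‖H‖ := by
      -- Expanding at `Y` gives `tr (Y⁻¹H) < 0`; replacing `Y⁻¹` by `X⁻¹` costs at most `c₁ * ‖H‖`.
      have h1 := det_lt_det_mul_exp hY hX fun h => hH0 (by rw [hH, h, sub_self])
      have h2 : 0 < (Y.1⁻¹ * (X.1 - Y.1)).trace := by
        by_contra! hle
        have := mul_le_mul_of_nonneg_left (Real.exp_le_one_iff.mpr hle) hY.det_pos.le
        linarith
      have h3 : (Y.1⁻¹ * (X.1 - Y.1)).trace = -(Y.1⁻¹ * H).trace := by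
        rw [← Matrix.trace_neg, ← Matrix.mul_neg, hH, neg_sub]
      have h4 := (le_abs_self _).trans (abs_trace_mul_le (X.1⁻¹ - Y.1⁻¹) H)
      rw [Matrix.sub_mul, Matrix.trace_sub] at h4
      have h5 : (d : ℝ) ^ 2 * ‖X.1⁻¹ - Y.1⁻¹‖ ≤ c₁ := by
        rw [lt_div_iff₀ (by positivity)] at hY3
        nlinarith [norm_nonneg (X.1⁻¹ - Y.1⁻¹)]
      have h6 := mul_le_mul_of_nonneg_right h5 hHpos.le
      linarith
    obtain ⟨w, hw, hle⟩ := hneg₁ H hHt hH0 htr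
    rw [div_mul_eq_mul_div, le_div_iff₀ hc₁]
    linarith [hHw w hw]
  have hn0 : n = 0 := by
    by_contra hn0
    have hnpos : 0 < ‖n‖ := norm_pos_iff.mpr hn0
    obtain ⟨w, hw, i, hle⟩ := hneg₂ n hn0
    have hr0 : ‖w‖ ≤ |r| := (hr w hw).trans (le_abs_self r)
    have hn1 : ‖n‖ ≤ 1 := (hY2.trans_le (min_le_left _ _)).le
    have hn2 : ‖n‖ * (K + 1) < c₂ :=
      (lt_div_iff₀ (by positivity)).mp (hY2.trans_le (min_le_right _ _))
    have e1 : quadValue H w ≤ d ^ 2 * |r| ^ 2 * (B / c₁) * ‖n‖ ^ 2 :=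
      calc _ ≤ (d : ℝ) ^ 2 * ‖H‖ * ‖w‖ ^ 2 := (le_abs_self _).trans (abs_quadValue_le H w)
        _ ≤ d ^ 2 * (B / c₁ * ‖n‖ ^ 2) * |r| ^ 2 := by gcongr
        _ = _ := by ring
    have e2 : w ⬝ᵥ H *ᵥ D w i ≤ 2 * d ^ 2 * |r| * (B / c₁) * ‖n‖ ^ 2 :=
      calc _ ≤ (d : ℝ) ^ 2 * ‖H‖ * ‖w‖ * ‖D w i‖ :=
            (le_abs_self _).trans (abs_dotProduct_mulVec_le H w _)
        _ ≤ d ^ 2 * (B / c₁ * ‖n‖ ^ 2) * |r| * (2 * 1) := by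
            gcongr
            exact (hDn w i).trans (by linarith)
        _ = _ := by ring
    have e3 := hlen w hw i
    have e4 := hQD w i
    -- The contact chosen by `hneg₂` shrinks linearly in `‖n‖`, and only quadratic terms can
    -- compensate.
    have e5 : 0 ≤ K * ‖n‖ ^ 2 - 2 * (c₂ * ‖n‖) := by
      rw [hK]; linarith
    have e6 : K * ‖n‖ ^ 2 ≤ c₂ * ‖n‖ := by
      rw [sq, ← mul_assoc]
      exact mul_le_mul_of_nonneg_right (by linarith) hnpos.le
    have e7 := mul_pos hc₂ hnpos
    linarith
  have hH0 : H = 0 := by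
    rw [hn0, norm_zero] at hHn
    exact norm_le_zero_iff.mp (by simpa using hHn)
  exact hne (Prod.ext (sub_eq_zero.mp hH0) (sub_eq_zero.mp hn0))

end Isolated

/-! ### Extremality gives Voronoi rigidity. -/

section Voronoi

variable {d k : ℕ}

theorem eventually_posDef {Q : Matrix (Fin d) (Fin d) ℝ} (hQ : Q.PosDef) :
    ∀ᶠ R in 𝓝 Q, Rᵀ = R → R.PosDef := by
  obtain ⟨c, hc, hev⟩ := exists_eventually_le_quadValue hQ
  filter_upwards [hev] with R hR hsymm
  refine .of_dotProduct_mulVec_pos ?_ fun x hx => ?_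
  · rwa [Matrix.IsHermitian, Matrix.conjTranspose_eq_transpose_of_trivial]
  · have := hR x
    have h2 : 0 < ‖x‖ := norm_pos_iff.mpr hx
    simp only [star_trivial]
    exact lt_of_lt_of_le (by positivity) this

/-- The minimal gap vectors of a periodic form. -/
def minGaps (X : FormSpace d k) : Set (Fin d → ℝ) :=
  {w | quadValue X.1 w = arithMin X ∧ ∃ i j v, (i = j → v ≠ 0) ∧
    translation X i - translation X j - intVec v = w}

theorem finite_minGaps {X : FormSpace d k} (hX : X ∈ periodicForms d k) : (minGaps X).Finite := by
  refine ((finite_gapValue_le hX (arithMin X)).image fun p =>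
    translation X p.1 - translation X p.2.1 - intVec p.2.2).subset ?_
  rintro _ ⟨hw, i, j, v, hv, rfl⟩
  exact ⟨(i, j, v), hw.le, rfl⟩

/-- A violating `H ≠ 0` would improve `X`: along `X.1 + s • H` no minimal gap shrinks and the others
stay above `λ` for small `s`, while strict concavity of `log det` makes the determinant drop even if
the trace vanishes. -/
theorem IsMExtreme.voronoiRigid (hd : 0 < d) {X : FormSpace d k} (h : IsMExtreme X)
    (hpos : 0 < arithMin X) : VoronoiRigid X.1 (minGaps X) := by
  obtain ⟨hX, hmax⟩ := h
  intro H hH hHw htr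
  by_contra hH0
  have hcont : Tendsto (fun s : ℝ => ((X.1 + s • H, X.2) : FormSpace d k)) (𝓝[>] 0) (𝓝 X) := by
    have : Continuous fun s : ℝ => ((X.1 + s • H, X.2) : FormSpace d k) := by fun_prop
    simpa using (this.tendsto 0).mono_left nhdsWithin_le_nhds
  have hXt : X.1ᵀ = X.1 := by
    simpa [Matrix.conjTranspose_eq_transpose_of_trivial] using hX.isHermitian.eq
  have hpd : ∀ᶠ s : ℝ in 𝓝[>] 0, ((X.1 + s • H, X.2) : FormSpace d k) ∈ periodicForms d k := by
    filter_upwards [hcont.eventually ((continuous_fst.tendsto X).eventually (eventually_posDef hX))]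
      with s hs
    exact hs (by rw [Matrix.transpose_add, Matrix.transpose_smul, hXt, hH])
  have hle := (tendsto_nhdsWithin_iff.mpr ⟨hcont, hpd⟩).eventually hmax
  obtain ⟨s, hs, hspd, hsgap, hspos⟩ := (hle.and (hpd.and
    ((hcont.eventually (eventually_lt_gapValue hX (arithMin X))).and
      self_mem_nhdsWithin))).exists
  replace hspos : 0 < s := hspos
  have hmin : arithMin X ≤ arithMin ((X.1 + s • H, X.2) : FormSpace d k) := by
    refine le_arithMin hd fun i j v hv => ?_
    rcases (arithMin_le hX hv).eq_or_lt with heq | hlt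
    · have hval : gapValue ((X.1 + s • H, X.2) : FormSpace d k) i j v = gapValue X i j v +
          s * quadValue H (translation X i - translation X j - intVec v) := by
        rw [gapValue, quadValue_add_left, quadValue_smul_left,
          translation_congr (X := ((X.1 + s • H, X.2) : FormSpace d k)) (Y := X) rfl]
        rfl
      rw [hval, ← heq]
      exact le_add_of_nonneg_right
        (mul_nonneg hspos.le (hHw _ ⟨heq.symm, i, j, v, hv, rfl⟩))
    · exact (hsgap i j v hlt).le
  have hdet : (X.1 + s • H).det < X.1.det := by
    have h1 := det_lt_det_mul_exp hX hspd fun h => by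
      rw [add_eq_left, smul_eq_zero] at h
      exact h.elim hspos.ne' hH0
    refine h1.trans_le (mul_le_of_le_one_right hX.det_pos.le (Real.exp_le_one_iff.mpr ?_))
    dsimp only
    rw [add_sub_cancel_left, Matrix.mul_smul, Matrix.trace_smul]
    exact mul_nonpos_of_nonneg_of_nonpos hspos.le htr
  exact absurd hs (not_le.mpr
    (density_lt_density_of_det_lt hd hspd hX (hpos.trans_le hmin) hmin hdet))

/-- Rigidity is invariant under integral, and in fact real, changes of coordinates. -/
theorem VoronoiRigid.of_coordinateChange {Q : Matrix (Fin d) (Fin d) ℝ} {W W' : Set (Fin d → ℝ)}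
    {P : Matrix (Fin d) (Fin d) ℝ} (hP : IsUnit P.det)
    (hW : ∀ w ∈ W', P *ᵥ w ∈ W) (h : VoronoiRigid (Pᵀ * Q * P) W') : VoronoiRigid Q W := by
  intro H hH hHw htr
  have hPt : IsUnit (Pᵀ).det := by rwa [Matrix.det_transpose]
  have h0 : Pᵀ * H * P = 0 := by
    refine h _ ?_ (fun w hw => ?_) ?_
    · simp [Matrix.mul_assoc, hH]
    · rw [quadValue_transpose_mul_mul]
      exact hHw _ (hW w hw)
    · rwa [Matrix.mul_assoc, Matrix.mul_inv_rev, Matrix.mul_inv_rev, Matrix.mul_assoc Pᵀ,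
        Matrix.mul_assoc, Matrix.mul_assoc, Matrix.nonsing_inv_mul_cancel_left _ _ hPt,
        Matrix.trace_mul_comm, Matrix.mul_assoc, Matrix.mul_assoc,
        Matrix.mul_nonsing_inv _ hP, Matrix.mul_one]
  have h1 : (Pᵀ)⁻¹ * (Pᵀ * H * P) * P⁻¹ = H := by
    rw [Matrix.mul_assoc Pᵀ, Matrix.nonsing_inv_mul_cancel_left _ _ hPt,
      Matrix.mul_nonsing_inv_cancel_right _ _ hP]
  rw [← h1, h0]
  simp

end Voronoi

/-! ### Lattices, basis matrices, and lattices as periodic sets. -/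

section Lattices

open Module

variable {d k : ℕ}

/-- The columns of `A` form a `ℤ`-basis of `L`. -/
def IsBasisMatrix (A : Matrix (Fin d) (Fin d) ℝ)
    (L : Submodule ℤ (EuclideanSpace ℝ (Fin d))) : Prop :=
  IsUnit A.det ∧ ∀ x, x ∈ L ↔ ∃ v : Fin d → ℤ, x = WithLp.toLp 2 (A *ᵥ intVec v)

theorem mulVec_injective_of_isUnit_det {A : Matrix (Fin d) (Fin d) ℝ} (hA : IsUnit A.det) :
    Function.Injective A.mulVec :=
  Matrix.mulVec_injective_of_isUnit ((Matrix.isUnit_iff_isUnit_det A).mpr hA)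

theorem mem_span_range_basis_iff (b : Basis (Fin d) ℝ (EuclideanSpace ℝ (Fin d)))
    (x : EuclideanSpace ℝ (Fin d)) : x ∈ Submodule.span ℤ (Set.range b) ↔
      ∃ v : Fin d → ℤ, x = ∑ i, (v i : ℝ) • b i := by
  rw [b.mem_span_iff_repr_mem ℤ]
  constructor
  · intro h
    choose v hv using h
    refine ⟨v, ?_⟩
    conv_lhs => rw [← b.sum_repr x]
    exact Finset.sum_congr rfl fun i _ => by rw [← hv i]; rfl
  · rintro ⟨v, rfl⟩ i
    exact ⟨v i, by simp [Finsupp.single_apply]⟩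

theorem toLp_mulVec_eq_sum (A : Matrix (Fin d) (Fin d) ℝ) (x : Fin d → ℝ) :
    WithLp.toLp 2 (A *ᵥ x) = ∑ i, x i • WithLp.toLp 2 (A.col i) := by
  ext a
  simp [Matrix.mulVec, dotProduct, mul_comm]

theorem exists_isBasisMatrix (L : Submodule ℤ (EuclideanSpace ℝ (Fin d))) [DiscreteTopology L]
    [IsZLattice ℝ L] : ∃ A, IsBasisMatrix A L := by
  have : Module.Finite ℤ L := ZLattice.module_finite ℝ L
  have : Module.Free ℤ L := ZLattice.module_free ℝ L
  have hrank : finrank ℤ L = d := by rw [ZLattice.rank ℝ L, finrank_euclideanSpace_fin]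
  let b := (finBasisOfFinrankEq ℤ L hrank).ofZLatticeBasis ℝ L
  have hb : Submodule.span ℤ (Set.range b) = L := Basis.ofZLatticeBasis_span ℝ L _
  let A : Matrix (Fin d) (Fin d) ℝ := Matrix.of fun a i => b i a
  have hA : ∀ x, WithLp.toLp 2 (A *ᵥ x) = ∑ i, x i • b i := fun x => by
    rw [toLp_mulVec_eq_sum]; rfl
  refine ⟨A, ?_, fun x => ?_⟩
  · rw [← Matrix.isUnit_iff_isUnit_det, ← Matrix.mulVec_injective_iff_isUnit]
    intro x y hxy
    have h1 : ∑ i, x i • b i = ∑ i, y i • b i := by rw [← hA, ← hA, hxy]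
    have h2 := congrArg b.equivFun h1
    rwa [← b.equivFun_symm_apply, ← b.equivFun_symm_apply, LinearEquiv.apply_symm_apply,
      LinearEquiv.apply_symm_apply] at h2
  · simp only [hA]
    conv_lhs => rw [← hb]
    exact mem_span_range_basis_iff b x

theorem exists_lattice_of_isUnit_det {A : Matrix (Fin d) (Fin d) ℝ} (hA : IsUnit A.det) :
    ∃ (L : Submodule ℤ (EuclideanSpace ℝ (Fin d))) (_ : DiscreteTopology L),
      IsZLattice ℝ L ∧ IsBasisMatrix A L := by
  let f : (Fin d → ℝ) →ₗ[ℝ] EuclideanSpace ℝ (Fin d) :=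
    (WithLp.linearEquiv 2 ℝ (Fin d → ℝ)).symm.toLinearMap ∘ₗ A.mulVecLin
  have hinj : Function.Injective f := fun x y h =>
    mulVec_injective_of_isUnit_det hA ((WithLp.linearEquiv 2 ℝ (Fin d → ℝ)).symm.injective h)
  let e := f.linearEquivOfInjective hinj (by simp)
  let b := (Pi.basisFun ℝ (Fin d)).map e
  refine ⟨Submodule.span ℤ (Set.range b), inferInstance, inferInstance, hA, fun x => ?_⟩
  have hb : ∀ i, b i = WithLp.toLp 2 (A.col i) := fun i => by
    change WithLp.toLp 2 (A *ᵥ (Pi.basisFun ℝ (Fin d) i)) = _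
    simp
  rw [mem_span_range_basis_iff]
  simp only [toLp_mulVec_eq_sum, hb]
  rfl

section Translates

variable {X : FormSpace d k} {A : Matrix (Fin d) (Fin d) ℝ}
  {L : Submodule ℤ (EuclideanSpace ℝ (Fin d))} {τ : Fin (k + 1) → EuclideanSpace ℝ (Fin d)}

theorem distinctTranslates_iff_incongruent (hA : IsBasisMatrix A L)
    (hτ : ∀ i j, τ i - τ j = WithLp.toLp 2 (A *ᵥ (translation X i - translation X j))) :
    DistinctTranslates L τ ↔ Incongruent X := by
  refine forall_congr' fun i => forall_congr' fun j => forall_congr' fun _ => ?_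
  rw [hA.2, hτ, not_exists]
  refine forall_congr' fun v => not_congr ⟨fun h => ?_, fun h => by rw [h]⟩
  exact mulVec_injective_of_isUnit_det hA.1 (WithLp.toLp_injective 2 h)

/-- Incongruence matters: `infsep` ignores coincident points, whereas two congruent translates would
make `λ` zero. -/
theorem infsep_unionTranslates (hd : 0 < d) (hA : IsBasisMatrix A L) (hX : X.1 = Aᵀ * A)
    (hinc : Incongruent X)
    (hτ : ∀ i j, τ i - τ j = WithLp.toLp 2 (A *ᵥ (translation X i - translation X j))) :
    (unionTranslates L τ).infsep = √(arithMin X) := by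
  have hXp : X ∈ periodicForms d k := by
    change X.1.PosDef
    rw [hX]
    exact posDef_transpose_mul_self hA.1
  have hmem : ∀ v : Fin d → ℤ, WithLp.toLp 2 (A *ᵥ intVec v) ∈ L := fun v => (hA.2 _).mpr ⟨v, rfl⟩
  have hdist : ∀ i j (u v : Fin d → ℤ), dist (τ i + WithLp.toLp 2 (A *ᵥ intVec u))
      (τ j + WithLp.toLp 2 (A *ᵥ intVec v)) = √(gapValue X i j (v - u)) := fun i j u v => by
    have h1 : τ i + WithLp.toLp 2 (A *ᵥ intVec u) - (τ j + WithLp.toLp 2 (A *ᵥ intVec v)) =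
        WithLp.toLp 2 (A *ᵥ (translation X i - translation X j - intVec (v - u))) := by
      rw [Matrix.mulVec_sub, intVec_sub, Matrix.mulVec_sub A (intVec v), WithLp.toLp_sub,
        WithLp.toLp_sub, ← hτ]
      abel
    rw [dist_eq_norm, h1, gapValue, hX, quadValue_transpose_mul_self, Real.sqrt_sq (norm_nonneg _)]
  obtain ⟨i, j, v, hv, heq⟩ := exists_gapValue_eq_arithMin hd hXp
  have hx : τ i + WithLp.toLp 2 (A *ᵥ intVec 0) ∈ unionTranslates L τ := ⟨i, _, hmem 0, rfl⟩
  have hy : τ j + WithLp.toLp 2 (A *ᵥ intVec v) ∈ unionTranslates L τ := ⟨j, _, hmem v, rfl⟩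
  have hd1 := hdist i j 0 v
  rw [sub_zero, heq] at hd1
  have hne : τ i + WithLp.toLp 2 (A *ᵥ intVec 0) ≠ τ j + WithLp.toLp 2 (A *ᵥ intVec v) := by
    rw [← dist_pos, hd1]
    exact Real.sqrt_pos.mpr (arithMin_pos hd hXp hinc)
  refine le_antisymm ((Set.infsep_le_dist_of_mem hx hy hne).trans hd1.le)
    (Set.Nontrivial.le_infsep ⟨_, hx, _, hy, hne⟩ ?_)
  rintro _ ⟨i, x, hx, rfl⟩ _ ⟨j, y, hy, rfl⟩ hxy
  obtain ⟨u, rfl⟩ := (hA.2 x).mp hx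
  obtain ⟨v, rfl⟩ := (hA.2 y).mp hy
  rw [hdist]
  refine Real.sqrt_le_sqrt (arithMin_le hXp ?_)
  rintro rfl h
  exact hxy (by rw [sub_eq_zero.mp h])

end Translates

/-- A representation of a lattice: the standard set is the preimage of the lattice under `A`. -/
theorem Represents.exists_matrix {X : FormSpace d k}
    {Λ : Submodule ℤ (EuclideanSpace ℝ (Fin d))}
    (h : Represents X (Λ : Set (EuclideanSpace ℝ (Fin d)))) :
    ∃ A : Matrix (Fin d) (Fin d) ℝ, IsUnit A.det ∧ X.1 = Aᵀ * A ∧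
      ∀ y, y ∈ standardSet X ↔ WithLp.toLp 2 (A *ᵥ y) ∈ Λ := by
  obtain ⟨-, A, b, hA, hX, hΛ⟩ := h
  have hmem : ∀ x, x ∈ Λ ↔ ∃ y ∈ standardSet X, WithLp.toLp 2 (b + A *ᵥ y) = x := fun x => by
    rw [← SetLike.mem_coe, hΛ]; rfl
  -- As `t_m = 0`, the shift `b` is itself a lattice point and can be dropped.
  have hb : WithLp.toLp 2 b ∈ Λ := (hmem _).mpr ⟨0, ⟨Fin.last k, 0, by simp⟩, by simp⟩
  refine ⟨A, hA, hX, fun y => ⟨fun hy => ?_, fun hy => ?_⟩⟩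
  · have := Λ.sub_mem ((hmem _).mpr ⟨y, hy, rfl⟩) hb
    rwa [← WithLp.toLp_sub, add_sub_cancel_left] at this
  · obtain ⟨z, hz, hzy⟩ := (hmem _).mp (Λ.add_mem hb hy)
    rw [← WithLp.toLp_add] at hzy
    rwa [← mulVec_injective_of_isUnit_det hA (add_left_cancel (WithLp.toLp_injective 2 hzy))]

section StandardSet

variable {X : FormSpace d k} {A : Matrix (Fin d) (Fin d) ℝ}
  {Λ : Submodule ℤ (EuclideanSpace ℝ (Fin d))}

theorem sub_mem_standardSet (hΛ : ∀ y, y ∈ standardSet X ↔ WithLp.toLp 2 (A *ᵥ y) ∈ Λ)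
    {x y : Fin d → ℝ} (hx : x ∈ standardSet X) (hy : y ∈ standardSet X) :
    x - y ∈ standardSet X := by
  rw [hΛ] at *
  rw [Matrix.mulVec_sub, WithLp.toLp_sub]
  exact Λ.sub_mem hx hy

theorem translation_add_intVec_mem (i : Fin (k + 1)) (v : Fin d → ℤ) :
    translation X i + intVec v ∈ standardSet X := ⟨i, v, rfl⟩

theorem gap_mem_standardSet (hΛ : ∀ y, y ∈ standardSet X ↔ WithLp.toLp 2 (A *ᵥ y) ∈ Λ)
    (i j : Fin (k + 1)) (v : Fin d → ℤ) :
    translation X i - translation X j - intVec v ∈ standardSet X := by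
  have := sub_mem_standardSet hΛ (translation_add_intVec_mem (X := X) i 0)
    (translation_add_intVec_mem (X := X) j v)
  rwa [intVec_zero, add_zero, ← sub_sub] at this

theorem exists_gap_eq (hΛ : ∀ y, y ∈ standardSet X ↔ WithLp.toLp 2 (A *ᵥ y) ∈ Λ)
    {w : Fin d → ℝ} (hw : w ∈ standardSet X) (hw0 : w ≠ 0) (i : Fin (k + 1)) :
    ∃ j v, (i = j → v ≠ 0) ∧ translation X i - translation X j - intVec v = w := by
  obtain ⟨j, v, hv⟩ := sub_mem_standardSet hΛ (translation_add_intVec_mem (X := X) i 0) hw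
  have hgap : translation X i - translation X j - intVec v = w := by
    rw [intVec_zero, add_zero] at hv
    linear_combination hv
  refine ⟨j, v, ?_, hgap⟩
  rintro rfl rfl
  exact hw0 (by rw [← hgap]; simp)

/-- Translation by a lattice vector permutes the translates. -/
theorem exists_perm_gap_eq (hinc : Incongruent X)
    (hΛ : ∀ y, y ∈ standardSet X ↔ WithLp.toLp 2 (A *ᵥ y) ∈ Λ)
    {w : Fin d → ℝ} (hw : w ∈ standardSet X) (hw0 : w ≠ 0) :
    ∃ σ : Equiv.Perm (Fin (k + 1)), ∀ i, ∃ v : Fin d → ℤ, (i = σ i → v ≠ 0) ∧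
      translation X i - translation X (σ i) - intVec v = w := by
  choose f v hv hgap using exists_gap_eq hΛ hw hw0
  -- Two translates with the same neighbour along `w` would be congruent.
  have hinj : Function.Injective f := fun i j hij => by
    by_contra hne
    have h1 := hgap i
    rw [hij, ← hgap j] at h1
    refine hinc i j hne (v i - v j) ?_
    rw [intVec_sub]
    linear_combination h1
  exact ⟨Equiv.ofBijective f (Finite.injective_iff_bijective.mp hinj), fun i => ⟨v i, hv i, hgap i⟩⟩

/-- In a lattice every nonzero vector is a gap, and gaps are lattice vectors. Hence `λ` depends on
the lattice alone, which lets different representations be compared. -/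
theorem isLeast_arithMin (hd : 0 < d) (hinc : Incongruent X) (hA : IsUnit A.det)
    (hX : X.1 = Aᵀ * A) (hΛ : ∀ y, y ∈ standardSet X ↔ WithLp.toLp 2 (A *ᵥ y) ∈ Λ) :
    IsLeast {r | ∃ x ∈ Λ, x ≠ 0 ∧ r = ‖x‖ ^ 2} (arithMin X) := by
  have hXp : X ∈ periodicForms d k := by
    change X.1.PosDef
    rw [hX]
    exact posDef_transpose_mul_self hA
  constructor
  · obtain ⟨i, j, v, hv, heq⟩ := exists_gapValue_eq_arithMin hd hXp
    refine ⟨_, (hΛ _).mp (gap_mem_standardSet hΛ i j v), fun h0 => hinc.gap_ne_zero hv ?_, ?_⟩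
    · apply mulVec_injective_of_isUnit_det hA
      rw [Matrix.mulVec_zero]
      exact WithLp.toLp_injective 2 h0
    · rw [← quadValue_transpose_mul_self, ← hX, ← heq, gapValue]
  · rintro _ ⟨x, hx, hx0, rfl⟩
    have hAA : A *ᵥ (A⁻¹ *ᵥ x.ofLp) = x.ofLp := by
      rw [Matrix.mulVec_mulVec, Matrix.mul_nonsing_inv _ hA, Matrix.one_mulVec]
    have hy : A⁻¹ *ᵥ x.ofLp ∈ standardSet X := by
      rw [hΛ, hAA]; exact hx
    obtain ⟨j, v, hv, hgap⟩ := exists_gap_eq hΛ hy (fun h => hx0 (by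
      rw [h, Matrix.mulVec_zero] at hAA
      exact (WithLp.ofLp_injective 2 hAA.symm))) (Fin.last k)
    have := arithMin_le hXp hv
    rw [gapValue, hgap, hX, quadValue_transpose_mul_self, hAA] at this
    exact this

end StandardSet

end Lattices

/-! ### The two implications. -/

variable {d k : ℕ}

/-- A nonzero infinitesimal motion of the translates that is orthogonal to all contacts can be
followed at constant speed, so that the point set is floating. -/
theorem isFloating_of_contactMap_eq_zero (hd : 0 < d) {X : FormSpace d k} (hinc : Incongruent X)
    {A : Matrix (Fin d) (Fin d) ℝ} (hA : IsUnit A.det) (hX : X.1 = Aᵀ * A)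
    {Λ : Submodule ℤ (EuclideanSpace ℝ (Fin d))}
    (hΛ : ∀ y, y ∈ standardSet X ↔ WithLp.toLp 2 (A *ᵥ y) ∈ Λ)
    {n : Fin k → Fin d → ℝ} (hn : n ≠ 0)
    (hcontact : ∀ w ∈ minGaps X, ∀ i j v,
      translation X i - translation X j - intVec v = w → contactMap X.1 w i j n = 0) :
    IsFloating (Λ : Set (EuclideanSpace ℝ (Fin d))) := by
  have hXp : X ∈ periodicForms d k := by
    change X.1.PosDef
    rw [hX]
    exact posDef_transpose_mul_self hA
  have hXt : X.1ᵀ = X.1 := by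
    simpa [Matrix.conjTranspose_eq_transpose_of_trivial] using hXp.isHermitian.eq
  have hpos := arithMin_pos hd hXp hinc
  set N : FormSpace d k := (0, n) with hN
  have hcont : Continuous fun u : ℝ => X + u • N := by fun_prop
  obtain ⟨ε, hε, hball⟩ : ∃ ε > 0, ∀ u : ℝ, |u| ≤ ε → ∀ i j v,
      arithMin X < gapValue X i j v → arithMin X < gapValue (X + u • N) i j v := by
    have h1 : Tendsto (fun u : ℝ => X + u • N) (𝓝 0) (𝓝 X) := by
      simpa using hcont.tendsto 0
    obtain ⟨ε, hε, h2⟩ := Metric.eventually_nhds_iff.mp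
      (h1.eventually (eventually_lt_gapValue hXp (arithMin X)))
    exact ⟨ε / 2, by positivity, fun u hu => h2 (by
      rw [dist_zero_right, Real.norm_eq_abs]; linarith)⟩
  have htrans : ∀ (u : ℝ) i, translation (X + u • N) i =
      translation X i + u • translation N i := fun u i => by
    rw [translation_add, translation_smul]
  have hfst : ∀ u : ℝ, (X + u • N).1 = X.1 := fun u => by simp [hN]
  -- A minimal gap has no linear term in `u`, so its value changes by `u ^ 2` times a nonnegative
  -- number; the other gaps stay above `λ(X)` by the choice of `ε`.
  have hmin : ∀ u : ℝ, |u| ≤ ε → arithMin X ≤ arithMin (X + u • N) := fun u hu => by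
    refine le_arithMin hd fun i j v hv => ?_
    rcases (arithMin_le hXp hv).eq_or_lt with heq | hlt
    · have h0 : (translation X i - translation X j - intVec v) ⬝ᵥ
          X.1 *ᵥ (translation N i - translation N j) = 0 :=
        hcontact _ ⟨heq.symm, i, j, v, hv, rfl⟩ i j v rfl
      have h1 : translation (X + u • N) i - translation (X + u • N) j - intVec v =
          (translation X i - translation X j - intVec v) +
            u • (translation N i - translation N j) := by
        rw [htrans, htrans, smul_sub]; abel
      rw [gapValue, h1, hfst, quadValue_add_right hXt, Matrix.mulVec_smul, dotProduct_smul, h0,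
        smul_zero, mul_zero, add_zero, heq]
      exact le_add_of_nonneg_right (quadValue_nonneg hXp _)
    · exact (hball u hu i j v hlt).le
  obtain ⟨L, hdisc, hlat, hL⟩ := exists_lattice_of_isUnit_det hA
  set γ : ℝ → Fin (k + 1) → EuclideanSpace ℝ (Fin d) := fun s i =>
    WithLp.toLp 2 (A *ᵥ translation (X + (s * ε) • N) i) with hγ
  have hγsub : ∀ s i j, γ s i - γ s j = WithLp.toLp 2 (A *ᵥ
      (translation (X + (s * ε) • N) i - translation (X + (s * ε) • N) j)) := fun s i j => by
    rw [Matrix.mulVec_sub, WithLp.toLp_sub]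
  have hγ0 : γ 0 = fun i => WithLp.toLp 2 (A *ᵥ translation X i) := by simp [hγ]
  have hunion : (Λ : Set (EuclideanSpace ℝ (Fin d))) = unionTranslates L (γ 0) := by
    ext x
    rw [hγ0, SetLike.mem_coe]
    have hAA : A *ᵥ (A⁻¹ *ᵥ x.ofLp) = x.ofLp := by
      rw [Matrix.mulVec_mulVec, Matrix.mul_nonsing_inv _ hA, Matrix.one_mulVec]
    constructor
    · intro hx
      obtain ⟨i, v, hv⟩ := (hΛ (A⁻¹ *ᵥ x.ofLp)).mpr (by rw [hAA]; exact hx)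
      refine ⟨i, _, (hL.2 _).mpr ⟨v, rfl⟩, ?_⟩
      dsimp only
      rw [← WithLp.toLp_add, ← Matrix.mulVec_add, ← hv, hAA]
    · rintro ⟨i, y, hy, rfl⟩
      obtain ⟨v, rfl⟩ := (hL.2 y).mp hy
      rw [← WithLp.toLp_add, ← Matrix.mulVec_add, ← hΛ]
      exact translation_add_intVec_mem i v
  have hinj : ∀ s i, γ s i = γ 0 i ↔ (s * ε) • translation N i = 0 := fun s i => by
    rw [hγ0]
    constructor
    · intro h
      have := mulVec_injective_of_isUnit_det hA (WithLp.toLp_injective 2 h)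
      rwa [htrans, add_eq_left] at this
    · intro h
      simp only [hγ]
      rw [htrans, h, add_zero]
  have hγcont : Continuous γ := by
    refine continuous_pi fun i => (PiLp.continuous_toLp 2 _).comp ?_
    have h1 : Continuous fun s : ℝ => translation (X + (s * ε) • N) i :=
      (continuous_translation i).comp (hcont.comp (continuous_mul_const ε))
    exact Continuous.matrix_mulVec continuous_const h1
  refine ⟨L, hdisc, hlat, k + 1, γ 0,
    (distinctTranslates_iff_incongruent hL (hγsub 0)).mpr (by simpa using hinc), hunion,
    {i | translation N i ≠ 0}, γ, ?_, ?_, hγcont.continuousOn, rfl, ?_, ?_, ?_⟩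
  · obtain ⟨i, hi⟩ := Function.ne_iff.mp hn
    exact ⟨i.castSucc, by simpa [hN] using hi⟩
  -- The last translate is pinned at `0`, so the moving ones form a strict subset.
  · intro h
    exact (Set.eq_univ_iff_forall.mp h (Fin.last k)) (translation_last N)
  · intro i hi
    refine ⟨1, by simp, fun h => hi ?_⟩
    rw [hinj, one_mul] at h
    exact (smul_eq_zero.mp h).resolve_left hε.ne'
  · intro i hi s _
    rw [hinj, not_not.mp hi, smul_zero]
  · intro s hs
    have hu : |s * ε| ≤ ε := by
      rw [abs_of_nonneg (mul_nonneg hs.1 hε.le)]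
      exact mul_le_of_le_one_left hε.le hs.2
    have hmem : X + (s * ε) • N ∈ periodicForms d k := by
      change (X + (s * ε) • N).1.PosDef
      rw [hfst]; exact hXp
    have hinc' := incongruent_of_arithMin_pos hmem (hpos.trans_le (hmin _ hu))
    refine ⟨(distinctTranslates_iff_incongruent hL (hγsub s)).mpr hinc', ?_⟩
    rw [hunion, infsep_unionTranslates (X := X) hd hL hX hinc (by simpa using hγsub 0),
      infsep_unionTranslates hd hL (by rw [hfst, hX]) hinc' (hγsub s)]
    exact Real.sqrt_le_sqrt (hmin _ hu)

/-- Rigidity of the matrix is transported from the `1`-extreme form by the change of coordinates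
`A⁻¹ * A₀`, which carries minimal vectors to minimal vectors; rigidity of the translates is the
absence of floating. -/
theorem IsExtreme.isStrictPeriodicExtreme (hd : 0 < d)
    {Λ : Submodule ℤ (EuclideanSpace ℝ (Fin d))}
    (hext : IsExtreme (Λ : Set (EuclideanSpace ℝ (Fin d))))
    (hfloat : ¬ IsFloating (Λ : Set (EuclideanSpace ℝ (Fin d)))) :
    IsStrictPeriodicExtreme (Λ : Set (EuclideanSpace ℝ (Fin d))) := by
  intro k X hrep
  obtain ⟨X₀, hrep₀, hext₀⟩ := hext
  obtain ⟨A, hA, hX, hΛ⟩ := hrep.exists_matrix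
  obtain ⟨A₀, hA₀, hX₀, hΛ₀⟩ := hrep₀.exists_matrix
  have hinc : Incongruent X := hrep.1
  have hinc₀ : Incongruent X₀ := hrep₀.1
  have hXp : X ∈ periodicForms d k := by
    change X.1.PosDef
    rw [hX]
    exact posDef_transpose_mul_self hA
  have hpos := arithMin_pos hd hXp hinc
  have hmin := (isLeast_arithMin hd hinc₀ hA₀ hX₀ hΛ₀).unique (isLeast_arithMin hd hinc hA hX hΛ)
  have hP : IsUnit (A⁻¹ * A₀).det := by
    rw [Matrix.det_mul]
    exact (Matrix.isUnit_nonsing_inv_det A hA).mul hA₀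
  have hAP : A * (A⁻¹ * A₀) = A₀ := Matrix.mul_nonsing_inv_cancel_left _ _ hA
  have hQ : (A⁻¹ * A₀)ᵀ * X.1 * (A⁻¹ * A₀) = X₀.1 := by
    rw [hX, ← Matrix.mul_assoc _ Aᵀ A, ← Matrix.transpose_mul, hAP, Matrix.mul_assoc, hAP, hX₀]
  have hmem : ∀ w ∈ minGaps X, w ∈ standardSet X ∧ w ≠ 0 := by
    rintro _ ⟨-, i, j, v, hv, rfl⟩
    exact ⟨gap_mem_standardSet hΛ i j v, hinc.gap_ne_zero hv⟩
  have hV : VoronoiRigid X.1 (minGaps X) := by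
    refine VoronoiRigid.of_coordinateChange hP (W' := minGaps X₀) ?_ ?_
    · rintro _ ⟨hw, i, j, v, hv, rfl⟩
      have hval := quadValue_transpose_mul_mul (A⁻¹ * A₀) X.1
        (translation X₀ i - translation X₀ j - intVec v)
      rw [hQ, hw, hmin] at hval
      refine ⟨hval.symm, Fin.last k, exists_gap_eq hΛ ?_ ?_ (Fin.last k)⟩
      · rw [hΛ, Matrix.mulVec_mulVec, hAP, ← hΛ₀]
        exact gap_mem_standardSet hΛ₀ i j v
      · intro h0
        rw [h0] at hval
        simp [quadValue] at hval
        exact hpos.ne' hval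
    · rw [hQ]
      exact hext₀.voronoiRigid hd (hmin ▸ hpos)
  have hperm : ∀ w : Fin d → ℝ, ∃ σ : Equiv.Perm (Fin (k + 1)), w ∈ minGaps X →
      ∀ i, ∃ v : Fin d → ℤ, (i = σ i → v ≠ 0) ∧
        translation X i - translation X (σ i) - intVec v = w := fun w => by
    by_cases hw : w ∈ minGaps X
    · obtain ⟨σ, hσ⟩ := exists_perm_gap_eq hinc hΛ (hmem w hw).1 (hmem w hw).2
      exact ⟨σ, fun _ => hσ⟩
    · exact ⟨1, fun h => absurd h hw⟩
  choose σ hσ using hperm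
  refine isIsolatedMExtreme_of_rigid hd hXp hpos (finite_minGaps hXp) (fun w hw => hw.1) σ hσ hV
    fun n hn => ?_
  by_contra hn0
  refine hfloat (isFloating_of_contactMap_eq_zero hd hinc hA hX hΛ hn0 fun w hw i j v hv => ?_)
  obtain ⟨u, -, hu⟩ := hσ w hw i
  -- By incongruence, the neighbour of `i` along `w` is unique, so the conditions on `σ` cover every
  -- minimal contact.
  have hj : σ w i = j := by
    by_contra hne
    refine hinc _ _ hne (v - u) ?_
    rw [intVec_sub]
    linear_combination hv - hu
  exact hj ▸ hn w hw i

theorem IsStrictPeriodicExtreme.isExtreme (hd : 0 < d)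
    {Λ : Submodule ℤ (EuclideanSpace ℝ (Fin d))} [DiscreteTopology Λ] [IsZLattice ℝ Λ]
    (h : IsStrictPeriodicExtreme (Λ : Set (EuclideanSpace ℝ (Fin d)))) :
    IsExtreme (Λ : Set (EuclideanSpace ℝ (Fin d))) := by
  obtain ⟨A, hA⟩ := exists_isBasisMatrix Λ
  let X : FormSpace d 0 := (Aᵀ * A, fun _ => 0)
  have htr : ∀ i, translation X i = 0 := fun i => by
    rw [Subsingleton.elim (α := Fin 1) i (Fin.last 0), translation_last]
  have hrep : Represents X (Λ : Set (EuclideanSpace ℝ (Fin d))) := by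
    refine ⟨fun i j hij => absurd (Subsingleton.elim (α := Fin 1) i j) hij, A, 0, hA.1, rfl, ?_⟩
    ext x
    rw [SetLike.mem_coe, hA.2]
    constructor
    · rintro ⟨v, rfl⟩
      exact ⟨intVec v, ⟨0, v, by rw [htr, zero_add]⟩, by simp⟩
    · rintro ⟨_, ⟨i, v, rfl⟩, rfl⟩
      exact ⟨v, by simp [htr]⟩
  have hiso := h 0 X hrep
  exact ⟨X, hrep, hiso.1, (hiso.eventually_of_le hd (arithMin_pos hd hiso.1 hrep.1)).mono
    fun Y hY => hY.1⟩

theorem IsStrictPeriodicExtreme.not_isFloating (hd : 0 < d)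
    {Λ : Set (EuclideanSpace ℝ (Fin d))} (h : IsStrictPeriodicExtreme Λ) : ¬ IsFloating Λ := by
  rintro ⟨L, _, _, m, t, hdist, hΛ, I, γ, ⟨i₀, hi₀⟩, hI, hγ, rfl, hmove, hfix, hmin⟩
  obtain ⟨j₀, hj₀⟩ := (Set.ne_univ_iff_exists_notMem I).mp hI
  obtain ⟨k, rfl⟩ : ∃ k, m = k + 1 := ⟨m - 1, by have := i₀.pos; omega⟩
  obtain ⟨A, hA⟩ := exists_isBasisMatrix L
  have hAA : ∀ x : EuclideanSpace ℝ (Fin d), WithLp.toLp 2 (A *ᵥ (A⁻¹ *ᵥ x.ofLp)) = x :=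
    fun x => by rw [Matrix.mulVec_mulVec, Matrix.mul_nonsing_inv _ hA.1, Matrix.one_mulVec]
  -- Relabel so that a translate `j₀` that never moves takes the last place, where the translation
  -- is normalized to `0`.
  let e : Equiv.Perm (Fin (k + 1)) := Equiv.swap j₀ (Fin.last k)
  have he : e (Fin.last k) = j₀ := Equiv.swap_apply_right _ _
  let X : ℝ → FormSpace d k := fun s =>
    (Aᵀ * A, fun i => A⁻¹ *ᵥ (γ s (e i.castSucc) - γ s j₀).ofLp)
  have htr : ∀ s i, translation (X s) i = A⁻¹ *ᵥ (γ s (e i) - γ s j₀).ofLp := fun s i => by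
    induction i using Fin.lastCases with
    | last => rw [translation_last, he, sub_self]; simp
    | cast i => rw [translation_castSucc]
  have hτ : ∀ s i j, γ s (e i) - γ s (e j) =
      WithLp.toLp 2 (A *ᵥ (translation (X s) i - translation (X s) j)) := fun s i j => by
    rw [htr, htr, Matrix.mulVec_sub, WithLp.toLp_sub, hAA, hAA]
    abel
  have hunion : ∀ s, unionTranslates L (γ s) = unionTranslates L fun i => γ s (e i) := fun s => by
    ext x
    exact e.exists_congr_left.trans (by simp [unionTranslates, e])
  have hinc : ∀ s ∈ Set.Icc (0 : ℝ) 1, Incongruent (X s) := fun s hs =>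
    (distinctTranslates_iff_incongruent hA (hτ s)).mp fun i j hij =>
      (hmin s hs).1 _ _ (e.injective.ne hij)
  have hXp : ∀ s, X s ∈ periodicForms d k := fun s => posDef_transpose_mul_self hA.1
  have h01 : (0 : ℝ) ∈ Set.Icc (0 : ℝ) 1 := by simp
  have hrep : Represents (X 0) Λ := by
    refine ⟨hinc 0 h01, A, (γ 0 j₀).ofLp, hA.1, rfl, ?_⟩
    rw [hΛ, hunion]
    have hpt : ∀ i (v : Fin d → ℤ), WithLp.toLp 2 ((γ 0 j₀).ofLp +
        A *ᵥ (translation (X 0) i + intVec v)) =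
        γ 0 (e i) + WithLp.toLp 2 (A *ᵥ intVec v) := fun i v => by
      rw [Matrix.mulVec_add, WithLp.toLp_add, WithLp.toLp_add, htr, hAA]
      simp only [WithLp.toLp_ofLp]
      abel
    ext x
    constructor
    · rintro ⟨i, y, hy, rfl⟩
      obtain ⟨v, rfl⟩ := (hA.2 y).mp hy
      exact ⟨_, ⟨i, v, rfl⟩, hpt i v⟩
    · rintro ⟨_, ⟨i, v, rfl⟩, rfl⟩
      exact ⟨i, _, (hA.2 _).mpr ⟨v, rfl⟩, hpt i v⟩
  have hpos := arithMin_pos hd (hXp 0) (hinc 0 h01)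
  have hev := (h k (X 0) hrep).eventually_of_le hd hpos
  -- The matrix is constant along the motion and the minimum distance never falls below its initial
  -- value.
  have hle : ∀ s ∈ Set.Icc (0 : ℝ) 1, density (X 0) ≤ density (X s) := fun s hs => by
    refine density_le_density_of_det_eq hd (hXp s) (hXp 0) ?_ rfl
    have h1 := (hmin s hs).2
    rw [hΛ, hunion, hunion s, infsep_unionTranslates hd hA rfl (hinc 0 h01) (hτ 0),
      infsep_unionTranslates hd hA rfl (hinc s hs) (hτ s)] at h1
    exact (Real.sqrt_le_sqrt_iff (arithMin_nonneg hd (hXp s))).mp h1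
  -- `X s` records positions relative to `j₀` only; since `j₀` is fixed, these determine `γ s`.
  have hsnd : ∀ s ∈ Set.Icc (0 : ℝ) 1, (X s).2 = (X 0).2 → γ s = γ 0 := fun s hs h2 => by
    funext i
    have h3 := congrFun (translation_congr h2) (e.symm i)
    rw [htr, htr, Equiv.apply_symm_apply] at h3
    have h4 := hAA (γ s i - γ s j₀)
    rw [h3, hAA, hfix j₀ hj₀ s hs] at h4
    exact (sub_left_injective h4).symm
  have hγc : Continuous fun s : Set.Icc (0 : ℝ) 1 => γ s :=
    continuousOn_iff_continuous_domRestrict.mp hγ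
  have hXc : Continuous fun s : Set.Icc (0 : ℝ) 1 => X s := by
    refine continuous_const.prodMk (continuous_pi fun i => ?_)
    refine Continuous.matrix_mulVec continuous_const ((PiLp.continuous_ofLp 2 _).comp ?_)
    exact ((continuous_apply _).comp hγc).sub ((continuous_apply _).comp hγc)
  -- The motion may rest at first, so looking at small times is not enough. Whenever it is at its
  -- start, isolation keeps it there for nearby times, which makes this set open; connectedness of
  -- `[0, 1]` does the rest.
  have hclopen : IsClopen {s : Set.Icc (0 : ℝ) 1 | γ s = γ 0} := by
    refine ⟨isClosed_eq hγc continuous_const, isOpen_iff_mem_nhds.mpr fun s hs => ?_⟩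
    have hXs : X s = X 0 := by
      simp only [X]
      rw [show γ s = γ 0 from hs]
    have hlim : Tendsto (fun s : Set.Icc (0 : ℝ) 1 => X s) (𝓝 s) (𝓝[periodicForms d k] X 0) :=
      tendsto_nhdsWithin_iff.mpr ⟨hXs ▸ hXc.tendsto s, .of_forall fun s => hXp s⟩
    filter_upwards [hlim.eventually hev] with r hr
    exact hsnd r r.2 (hr.2 (hle r r.2))
  have huniv := hclopen.eq_univ ⟨⟨0, h01⟩, rfl⟩
  obtain ⟨s, hs, hne⟩ := hmove i₀ hi₀
  have : (⟨s, hs⟩ : Set.Icc (0 : ℝ) 1) ∈ {s : Set.Icc (0 : ℝ) 1 | γ s = γ 0} :=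
    huniv ▸ Set.mem_univ _
  exact hne (congrFun this i₀)

end StrictPeriodic

end

theorem mainTheorem2 (d : ℕ) (hd : 0 < d) (Λ : Submodule ℤ (EuclideanSpace ℝ (Fin d)))
    [DiscreteTopology Λ] [IsZLattice ℝ Λ] :
    StrictPeriodic.IsStrictPeriodicExtreme (Λ : Set (EuclideanSpace ℝ (Fin d))) ↔
      StrictPeriodic.IsExtreme (Λ : Set (EuclideanSpace ℝ (Fin d))) ∧
        ¬ StrictPeriodic.IsFloating (Λ : Set (EuclideanSpace ℝ (Fin d))) :=
  ⟨fun h => ⟨h.isExtreme hd, h.not_isFloating hd⟩, fun h => h.1.isStrictPeriodicExtreme hd h.2⟩
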